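/- Let $p$ be a prime, $s\ge 2$, and let $t_1\ge 1$, $t_2,\dots,t_{s-1}\ge 0$, $t_s\ge 1$ be integers. **Gray map.** For $u\in\mathbb{Z}_{p^r}$ with $p$-ary expansion $u=\sum_{i=0}^{r-1}u_ip^i$, let $\phi_r(u)=(u_{r-1},\dots,u_{r-1})+(u_0,\dots,u_{r-2})Y_{r-1}\in\mathbb{Z}_p^{p^{r-1}}$, where the columns of the $(r-1)\times p^{r-1}$ matrix $Y_{r-1}$ are the $p$-ary digit vectors of $0,1,\dots,p^{r-1}-1$, in this order. Let $\Phi:\mathbb{Z}_p^{\alpha_1}\times\mathbb{Z}_{p^2}^{\alpha_2}\times\cdots\times\mathbb{Z}_{p^s}^{\alpha_s}\to\mathbb{Z}_p^{n}$, $n=\alpha_1+p\alpha_2+\cdots+p^{s-1}\alpha_s$, apply $\phi_r$ to each coordinate over $\mathbb{Z}_{p^r}$ and concatenate the results. **GH codes.** A generalized Hadamard (GH) matrix $H(p,\lambda)$ is an $N\times N$ matrix $(h_{ij})$ over $\mathbb{Z}_p$, $N=p\lambda$, such that for all $i<j$ the multiset $\{h_{ik}-h_{jk}:1\le k\le N\}$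 contains every element of $\mathbb{Z}_p$ exactly $\lambda$ times; it is normalized if its first row and first column are zero. A GH code over $\mathbb{Z}_p$ is a set $\{h+a\mathbf 1: h \text{ a row of } H,\ a\in\mathbb{Z}_p\}$ with $H$ a normalized GH matrix. A subgroup $\mathcal C$ of $\mathbb{Z}_p^{\alpha_1}\times\cdots\times\mathbb{Z}_{p^s}^{\alpha_s}$ is a $\mathbb{Z}_p\mathbb{Z}_{p^2}\dots\mathbb{Z}_{p^s}$-additive GH code if $\Phi(\mathcal C)$ is a GH code; it is of type $(\alpha_1,\dots,\alpha_s;t_1,\dots,t_s)$ if $\mathcal C\cong\mathbb{Z}_{p^s}^{t_1}\times\mathbb{Z}_{p^{s-1}}^{t_2}\times\cdots\times\mathbb{Z}_p^{t_s}$. **The matrices.** Write $A=(A_1\mid\cdots\mid A_s)$, where the block $A_b$ has entries in $\mathbb{Z}_{p^b}$. Bold $\mathbf m$ denotes a constant row vector $(m,\dots,m)$ of the appropriate length. Let $A_p^{1,0,\dots,0,1}$ be the matrix with two rows whose first block has the columns $(1,m)^T$, $0\le m\le p-1$, and whose $b$-th block, $2\le b\le s$, has the columns $(p^{b-1},m)^T$,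 $1\le m\le p-1$. Given a matrix $A$ with $R$ rows and $i\in\{1,\dots,s\}$, adding a row of order $p^{s-i+1}$ yields the matrix with $R+1$ rows and the blocks $$\begin{pmatrix}A_1&\cdots&A_1\\ \mathbf 0&\cdots&\mathbf{p-1}\end{pmatrix},\quad P_1,\dots,P_{s-i},\quad Q_1,\dots,Q_{i-1},$$ $$P_j=\begin{pmatrix}M_j&\cdots&M_j&A_{j+1}&\cdots&A_{j+1}\\ \mathbf 1&\cdots&\mathbf{p-1}&\mathbf 0&\cdots&\mathbf{p^{j+1}-1}\end{pmatrix},\qquad Q_k=\begin{pmatrix}A_{s-i+k+1}&\cdots&A_{s-i+k+1}\\ p^k\cdot\mathbf 0&\cdots&p^k\cdot(\mathbf{p^{s-i+1}-1})\end{pmatrix},$$ over $\mathbb{Z}_p$, over $\mathbb{Z}_{p^{j+1}}$ and over $\mathbb{Z}_{p^{s-i+k+1}}$ respectively, where the columns of $M_j$ are the vectors $z^T$ with $z\in\{p^j\}\times\{p\cdot0,p\cdot1,\dots,p\cdot(p^j-1)\}^{R-1}$, in lexicographic order. Starting from $A_p^{1,0,\dots,0,1}$, add first $t_1-1$ rows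 of order $p^s$, then $t_2$ rows of order $p^{s-1}$, and so on, then $t_{s-1}$ rows of order $p^2$, and finally $t_s-1$ rows of order $p$. The result is $A_p^{t_1,\dots,t_s}$. **Theorem.** Let $\alpha_b$ be the number of columns of the block of $A_p^{t_1,\dots,t_s}$ over $\mathbb{Z}_{p^b}$, and let $\mathcal H_p^{t_1,\dots,t_s}\le\mathbb{Z}_p^{\alpha_1}\times\cdots\times\mathbb{Z}_{p^s}^{\alpha_s}$ be the subgroup generated by the rows of $A_p^{t_1,\dots,t_s}$. Then $\mathcal H_p^{t_1,\dots,t_s}$ is a $\mathbb{Z}_p\mathbb{Z}_{p^2}\dots\mathbb{Z}_{p^s}$-additive GH code, that is, $\Phi(\mathcal H_p^{t_1,\dots,t_s})$ is a GH code over $\mathbb{Z}_p$, and it is of type $(\alpha_1,\dots,\alpha_s;t_1,\dots,t_s)$. -/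

import Mathlib

namespace GHCode

/-! ### Additive codes, the Gray map, generalized Hadamard codes

Blocks, powers and types are indexed by `Fin s`, starting from `0`: block `b` consists of the
coordinates over the integers modulo `p ^ (b + 1)`. -/

/-- The group `ℤ_p^{α 0} × ℤ_{p²}^{α 1} × ⋯ × ℤ_{p^s}^{α (s-1)}`. -/
abbrev Ambient (p : ℕ) {s : ℕ} (α : Fin s → ℕ) : Type :=
  (b : Fin s) → Fin (α b) → ZMod (p ^ (b.val + 1))

/-- The `i`-th `p`-ary digit of the natural number `m`, as an element of `ℤ_p`. -/
def digit (p m i : ℕ) : ZMod p := ((m / p ^ i % p : ℕ) : ZMod p)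

/-- The Gray map `ℤ_{p^(b+1)} → ℤ_p^{p^b}`. The coordinate at position `c` belongs to the `c`-th
column of the matrix `Y`, that is, to the column of the `p`-ary digits of `c`. -/
def gray (p b : ℕ) (u : ZMod (p ^ (b + 1))) (c : Fin (p ^ b)) : ZMod p :=
  digit p u.val b + ∑ i ∈ Finset.range b, digit p u.val i * digit p c.val i

/-- The length of the Gray map image, `α 0 + p * α 1 + ⋯ + p ^ (s-1) * α (s-1)`. -/
def grayLength (p : ℕ) {s : ℕ} (α : Fin s → ℕ) : ℕ := ∑ b : Fin s, α b * p ^ b.val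

/-- The Gray map on the mixed alphabet: the images of all coordinates, one after the other. -/
def Phi (p : ℕ) {s : ℕ} (α : Fin s → ℕ) (u : Ambient p α) : Fin (grayLength p α) → ZMod p :=
  fun k =>
    let q : (b : Fin s) × Fin (α b * p ^ b.val) := finSigmaFinEquiv.symm k
    let c : Fin (α q.1) × Fin (p ^ q.1.val) := finProdFinEquiv.symm q.2
    gray p q.1.val (u q.1 c.1) c.2

/-- `H` is a generalized Hadamard matrix `H(p, lam)` of order `N = p * lam` over `ℤ_p`. -/
def IsGHMatrix (p N lam : ℕ) (H : Matrix (Fin N) (Fin N) (ZMod p)) : Prop :=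
  0 < lam ∧ N = p * lam ∧
    ∀ i j : Fin N, i < j → ∀ a : ZMod p,
      (Finset.univ.filter fun k : Fin N => H i k - H j k = a).card = lam

/-- The first row and the first column of `H` are zero. -/
def IsNormalized {p N : ℕ} (H : Matrix (Fin N) (Fin N) (ZMod p)) : Prop :=
  ∀ i k : Fin N, i.val = 0 ∨ k.val = 0 → H i k = 0

/-- The code of all rows of `H` and all their translates by constant vectors. -/
def codeOfMatrix {p N : ℕ} (H : Matrix (Fin N) (Fin N) (ZMod p)) : Set (Fin N → ZMod p) :=
  {v | ∃ (i : Fin N) (a : ZMod p), ∀ k, v k = H i k + a}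

/-- `C` is a generalized Hadamard code of length `N` over `ℤ_p`. -/
def IsGHCode (p N : ℕ) (C : Set (Fin N → ZMod p)) : Prop :=
  ∃ (lam : ℕ) (H : Matrix (Fin N) (Fin N) (ZMod p)),
    IsGHMatrix p N lam H ∧ IsNormalized H ∧ C = codeOfMatrix H

/-- An additive code is an additive GH code if its Gray map image is a GH code. -/
def IsAdditiveGHCode (p : ℕ) {s : ℕ} (α : Fin s → ℕ) (C : AddSubgroup (Ambient p α)) : Prop :=
  IsGHCode p (grayLength p α) (Phi p α '' (C : Set (Ambient p α)))

/-- The additive code `C` is of type `(α 0, …, α (s-1); t 0, …, t (s-1))`: it has `α b` coordinates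
over `ℤ_{p^(b+1)}` and is isomorphic to `ℤ_{p^s}^{t 0} × ℤ_{p^(s-1)}^{t 1} × ⋯ × ℤ_p^{t (s-1)}`. -/
def HasType (p : ℕ) {s : ℕ} (α t : Fin s → ℕ) (C : AddSubgroup (Ambient p α)) : Prop :=
  Nonempty (C ≃+ ((i : Fin s) → Fin (t i) → ZMod (p ^ (s - i.val))))

/-! ### The recursive construction -/

/-- A matrix with `r + 1` rows whose columns are grouped in `s` blocks; block `b` is given as the
list of its columns, which have entries in `ℤ_{p^(b+1)}`. -/
structure BlockMatrix (p s : ℕ) where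
  r : ℕ
  cols : (b : Fin s) → List (Fin (r + 1) → ZMod (p ^ (b.val + 1)))

/-- The number of columns of each block. -/
def BlockMatrix.alpha {p s : ℕ} (A : BlockMatrix p s) (b : Fin s) : ℕ := (A.cols b).length

/-- The rows of a block matrix. -/
def BlockMatrix.row {p s : ℕ} (A : BlockMatrix p s) (k : Fin (A.r + 1)) : Ambient p A.alpha :=
  fun b c => (A.cols b).get c k

/-- The additive code generated by the rows of a block matrix. -/
def BlockMatrix.code {p s : ℕ} (A : BlockMatrix p s) : AddSubgroup (Ambient p A.alpha) :=
  AddSubgroup.closure (Set.range A.row)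

/-- All vectors of length `n` with entries in the list `L`, in lexicographic order. -/
def lexVectors {R : Type} (L : List R) : (n : ℕ) → List (Fin n → R)
  | 0 => [Fin.elim0]
  | n + 1 => L.flatMap fun a => (lexVectors L n).map fun v => Fin.cons a v

/-- The columns `zᵀ` with `z ∈ {p^j} × {p·0, p·1, …, p·(p^j-1)}^r`, over `ℤ_{p^(j+1)}`. -/
def colsM (p r j : ℕ) : List (Fin (r + 1) → ZMod (p ^ (j + 1))) :=
  (lexVectors ((List.range (p ^ j)).map fun m => ((p * m : ℕ) : ZMod (p ^ (j + 1)))) r).map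
    fun z => Fin.cons ((p ^ j : ℕ) : ZMod (p ^ (j + 1))) z

/-- For each `m` in the list `L`, in this order, one copy of the columns `B` with the constant row
`d * m` added below: the matrix whose upper part is `B ⋯ B` and whose last row is made of the
constant vectors `d·𝐦`. -/
def stack {R : Type} [Semiring R] {n : ℕ} (B : List (Fin n → R)) (d : ℕ) (L : List ℕ) :
    List (Fin (n + 1) → R) :=
  L.flatMap fun m => B.map fun c => Fin.snoc (α := fun _ => R) c ((d * m : ℕ) : R)

/-- The matrix `A_p^{1,0,…,0,1}`. -/
def baseMatrix (p s : ℕ) : BlockMatrix p s where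
  r := 1
  cols b :=
    (if b.val = 0 then List.range p else List.range' 1 (p - 1)).map fun m =>
      ![((p ^ b.val : ℕ) : ZMod (p ^ (b.val + 1))), (m : ZMod (p ^ (b.val + 1)))]

/-- One step of the construction: add a row of order `p ^ (s - i)`. The three cases are the first
block, the blocks `P_j` with `j = b`, and the blocks `Q_k` with `k = b - (s - (i + 1))`. -/
def addRow {p s : ℕ} (A : BlockMatrix p s) (i : Fin s) : BlockMatrix p s where
  r := A.r + 1
  cols b :=
    if b.val = 0 then stack (A.cols b) 1 (List.range p)
    else if b.val ≤ s - (i.val + 1) then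
      stack (colsM p A.r b.val) 1 (List.range' 1 (p - 1)) ++
        stack (A.cols b) 1 (List.range (p ^ (b.val + 1)))
    else stack (A.cols b) (p ^ (b.val - (s - (i.val + 1)))) (List.range (p ^ (s - i.val)))

/-- The steps leading from `A_p^{1,0,…,0,1}` to `A_p^{t 0,…,t (s-1)}` in the prescribed order:
first `t 0 - 1` rows of order `p ^ s`, then `t 1` rows of order `p ^ (s-1)`, and so on, and
finally `t (s-1) - 1` rows of order `p`. -/
def steps {s : ℕ} (t : Fin s → ℕ) : List (Fin s) :=
  (List.finRange s).flatMap fun i =>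
    List.replicate (if i.val = 0 ∨ i.val = s - 1 then t i - 1 else t i) i

/-- The matrix `A_p^{t 0,…,t (s-1)}`. -/
def genMatrix (p : ℕ) {s : ℕ} (t : Fin s → ℕ) : BlockMatrix p s :=
  (steps t).foldl addRow (baseMatrix p s)

end GHCode

namespace GHCode

/-! ### A criterion for generalized Hadamard codes -/

/-! The first row of the matrix is `p ^ b` throughout block `b`, and adding `a` times it to a word
adds the constant `a` to the Gray image. For residues `u`, `v` modulo `p ^ (b + 1)`, the difference
of Gray images is constantly `a` if `u - v = a * p ^ b`, and otherwise takes every value equally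
often (`card_gray_sub`). Hence the distribution of values of `Phi u - Phi v` is governed by `weight
p (u - v)`, and the task is to show that the weight of a codeword is independent of `a`, unless the
word is a multiple of the first row.

Below the first row, the columns of block `b` represent the orbits, under residues congruent to `1`
modulo `p`, of the unimodular vectors whose entries respect the orders of the rows (`Represents`);
each orbit has `p ^ b` elements, which is the weight of the block. Multiplication by `p` identifies
vectors over smaller moduli with the non-unimodular ones over larger moduli, so all blocks together
amount to one finite group `T` of torsion vectors modulo `p ^ s` (`Presents.sum_cols`).

For the combination of rows with coefficients `x`, the weight at `a` therefore counts the `g` in `T`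
solving `x 0 * p ^ (s - 1) + ∑ x k * g k = a * p ^ (s - 1)`. If some `x k`, `k ≠ 0`, is not
divisible by the order of its row, a translation of `T` matches the solutions for any two values of
`a` (`Presents.weight_comb_eq`); otherwise the combination is `x 0` times the first row. This
dichotomy also determines all relations between the rows, hence the type and the cardinality `p *
|T| = p * N` of the code. -/

theorem isGHCode_of_differences {p N lam : ℕ} [NeZero p] (S : Set (Fin N → ZMod p))
    (hlam : 0 < lam) (hN : N = p * lam) (h0 : (fun _ => 0) ∈ S)
    (hadd : ∀ v ∈ S, ∀ a, (fun k => v k + a) ∈ S) (hcard : Nat.card S = p * N)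
    (hdiff : ∀ u ∈ S, ∀ v ∈ S, (∃ a, ∀ k, u k - v k = a) ∨
      ∀ a, (Finset.univ.filter fun k => u k - v k = a).card = lam) :
    IsGHCode p N S := by
  have hp : 0 < p := Nat.pos_of_ne_zero (NeZero.ne p)
  have hNpos : 0 < N := hN ▸ Nat.mul_pos hp hlam
  let z : Fin N := ⟨0, hNpos⟩
  let S₀ := {v : Fin N → ZMod p // v ∈ S ∧ v z = 0}
  let f : S ≃ S₀ × ZMod p :=
    { toFun := fun v => (⟨fun k => v.1 k + -v.1 z, hadd _ v.2 _, by simp⟩, v.1 z)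
      invFun := fun w => ⟨fun k => w.1.1 k + w.2, hadd _ w.1.2.1 _⟩
      left_inv := fun v => by ext k; simp
      right_inv := fun w => by
        obtain ⟨⟨w, hw, hz⟩, a⟩ := w
        refine Prod.ext (Subtype.ext (funext fun k => ?_)) ?_ <;> simp [hz] }
  have hS₀ : Nat.card S₀ = N := by
    have h := Nat.card_congr f
    rw [hcard, Nat.card_prod, Nat.card_zmod, mul_comm] at h
    exact (Nat.eq_of_mul_eq_mul_right hp h).symm
  let o : S₀ := ⟨fun _ => 0, h0, rfl⟩
  let e₀ : Fin N ≃ S₀ := (Finite.equivFinOfCardEq hS₀).symm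
  -- The words vanishing at `z` serve as rows of the matrix; the swap makes the zero word its first
  -- row.
  let e : Fin N ≃ S₀ := (Equiv.swap z (e₀.symm o)).trans e₀
  have hez : e z = o := by simp [e]
  refine ⟨lam, fun i k => (e i).1 k, ⟨hlam, hN, fun i j hij a => ?_⟩, ?_, ?_⟩
  · rcases hdiff _ (e i).2.1 _ (e j).2.1 with ⟨c, hc⟩ | h
    · have hc0 : c = 0 := by rw [← hc z, (e i).2.2, (e j).2.2, sub_zero]
      have : e i = e j := Subtype.ext (funext fun k => sub_eq_zero.1 ((hc k).trans hc0))
      exact absurd (e.injective this) hij.ne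
    · exact h a
  · rintro i k (h | h)
    · have : i = z := Fin.ext h
      subst this
      simp only [hez, o]
    · have : k = z := Fin.ext h
      subst this
      exact (e i).2.2
  · ext v
    constructor
    · intro hv
      refine ⟨e.symm (f ⟨v, hv⟩).1, v z, fun k => ?_⟩
      simp [f]
    · rintro ⟨i, a, h⟩
      rw [show v = fun k => (e i).1 k + a from funext h]
      exact hadd _ (e i).2.1 _

/-! ### The Gray map -/

theorem digit_eq_cast (p m i : ℕ) : digit p m i = ((m / p ^ i : ℕ) : ZMod p) := by
  simp [digit]

theorem digit_mod {p m i b : ℕ} (h : i ≤ b) : digit p (m % p ^ (b + 1)) i = digit p m i := by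
  unfold digit
  rw [show b + 1 = i + ((b - i) + 1) by omega, pow_add, Nat.mod_mul_right_div_self,
    Nat.mod_mod_of_dvd _ (Dvd.intro_left _ (pow_succ p (b - i)).symm)]

theorem digit_add_mul_pow_of_lt {p m i b a : ℕ} (hp : 0 < p) (h : i < b) :
    digit p (m + a * p ^ b) i = digit p m i := by
  rw [digit_eq_cast, digit_eq_cast, show b = i + ((b - i - 1) + 1) by omega, pow_add,
    show m + a * (p ^ i * p ^ (b - i - 1 + 1)) = m + p ^ i * (a * p ^ (b - i - 1 + 1)) by ring,
    Nat.add_mul_div_left _ _ (pow_pos hp i), pow_succ]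
  simp

theorem digit_add_mul_pow_self {p m b a : ℕ} (hp : 0 < p) :
    digit p (m + a * p ^ b) b = digit p m b + a := by
  rw [digit_eq_cast, digit_eq_cast, mul_comm, Nat.add_mul_div_left _ _ (pow_pos hp b)]
  simp

theorem digit_val_add_of_lt {p b i : ℕ} [NeZero p] (u : ZMod (p ^ (b + 1))) (a : ℕ) (h : i < b) :
    digit p (u + (a * p ^ b : ℕ)).val i = digit p u.val i := by
  conv_lhs => rw [← ZMod.natCast_zmod_val u, ← Nat.cast_add, ZMod.val_natCast, digit_mod h.le,
    digit_add_mul_pow_of_lt (Nat.pos_of_ne_zero (NeZero.ne p)) h]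

theorem digit_val_add_self {p b : ℕ} [NeZero p] (u : ZMod (p ^ (b + 1))) (a : ℕ) :
    digit p (u + (a * p ^ b : ℕ)).val b = digit p u.val b + a := by
  conv_lhs => rw [← ZMod.natCast_zmod_val u, ← Nat.cast_add, ZMod.val_natCast, digit_mod le_rfl,
    digit_add_mul_pow_self (Nat.pos_of_ne_zero (NeZero.ne p))]

/-- Adding a multiple of `p ^ b` changes only the leading digit, which enters every coordinate of
the Gray image with coefficient one. -/
theorem gray_add {p b : ℕ} [NeZero p] (u : ZMod (p ^ (b + 1))) (a : ℕ) (c : Fin (p ^ b)) :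
    gray p b (u + (a * p ^ b : ℕ)) c = gray p b u c + a := by
  unfold gray
  rw [digit_val_add_self, Finset.sum_congr rfl fun i hi => by
    rw [digit_val_add_of_lt u a (Finset.mem_range.1 hi)]]
  ring

theorem mod_pow_eq_of_digits {p b m n : ℕ} [NeZero p]
    (h : ∀ i < b, digit p m i = digit p n i) : m % p ^ b = n % p ^ b := by
  induction b with
  | zero => simp [Nat.mod_one]
  | succ b ih =>
    have hb := h b (Nat.lt_succ_self b)
    rw [digit_eq_cast, digit_eq_cast, ZMod.natCast_eq_natCast_iff'] at hb
    rw [Nat.mod_pow_succ, Nat.mod_pow_succ, hb, ih fun i hi => h i (hi.trans (Nat.lt_succ_self b))]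

/-- For `q = p ^ b` the term `q * p` vanishes modulo `p ^ (b + 1)`; it allows the leading digit of
`n` to be subtracted within the natural numbers. -/
theorem add_mul_eq_of_mod_eq {p q m n : ℕ} (h : m % q = n % q) (hn : n / q < p) :
    m + q * p = n + (m / q + (p - n / q)) * q := by
  have hm' := Nat.mod_add_div m q
  have hn' := Nat.mod_add_div n q
  obtain ⟨d, hd⟩ := Nat.exists_eq_add_of_lt hn
  rw [show p - n / q = d + 1 by omega, hd]
  linear_combination h - hm' + hn'

theorem exists_eq_add_of_digits {p b : ℕ} [NeZero p] {u v : ZMod (p ^ (b + 1))}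
    (h : ∀ i < b, digit p u.val i = digit p v.val i) :
    ∃ a : ℕ, u = v + (a * p ^ b : ℕ) := by
  have hlt : v.val / p ^ b < p := by
    rw [Nat.div_lt_iff_lt_mul (pow_pos (Nat.pos_of_ne_zero (NeZero.ne p)) b), ← pow_succ']
    exact v.val_lt
  refine ⟨u.val / p ^ b + (p - v.val / p ^ b), ?_⟩
  have key := congrArg (Nat.cast : ℕ → ZMod (p ^ (b + 1)))
    (add_mul_eq_of_mod_eq (mod_pow_eq_of_digits h) hlt)
  rw [Nat.cast_add, Nat.cast_add, ← pow_succ, ZMod.natCast_self, add_zero,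
    ZMod.natCast_zmod_val, ZMod.natCast_zmod_val] at key
  exact key

theorem cast_mul_pow_eq_iff {p b : ℕ} [NeZero p] {a a' : ℕ} :
    ((a * p ^ b : ℕ) : ZMod (p ^ (b + 1))) = (a' * p ^ b : ℕ) ↔ (a : ZMod p) = a' := by
  rw [ZMod.natCast_eq_natCast_iff, ZMod.natCast_eq_natCast_iff, pow_succ', Nat.ModEq, Nat.ModEq,
    Nat.mul_mod_mul_right, Nat.mul_mod_mul_right,
    Nat.mul_left_inj (pow_ne_zero b (NeZero.ne p))]

/-- A nonconstant affine function of the `p`-ary digits takes all values equally often. -/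
theorem card_digits_eq {p b : ℕ} [Fact p.Prime] (d : ℕ → ZMod p) (e : ZMod p) {i : ℕ}
    (hi : i < b) (hd : d i ≠ 0) (a a' : ZMod p) :
    (Finset.univ.filter fun c : Fin (p ^ b) =>
      e + ∑ i ∈ Finset.range b, d i * digit p c.val i = a).card =
    (Finset.univ.filter fun c : Fin (p ^ b) =>
      e + ∑ i ∈ Finset.range b, d i * digit p c.val i = a').card := by
  let E : Fin (p ^ b) ≃ (Fin b → ZMod p) :=
    finFunctionFinEquiv.symm.trans (Equiv.piCongrRight fun _ =>
      { toFun := fun x : Fin p => (x.val : ZMod p)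
        invFun := fun y => ⟨y.val, y.val_lt⟩
        left_inv := fun x => Fin.ext (ZMod.val_natCast_of_lt x.2)
        right_inv := fun y => ZMod.natCast_zmod_val y })
  have hE : ∀ c : Fin (p ^ b), ∀ j : Fin b, E c j = digit p c.val j := by
    intro c j
    simp [E, digit, finFunctionFinEquiv]
  have hcard : ∀ a : ZMod p, (Finset.univ.filter fun c : Fin (p ^ b) =>
      e + ∑ i ∈ Finset.range b, d i * digit p c.val i = a).card =
      (Finset.univ.filter fun w : Fin b → ZMod p => e + ∑ j : Fin b, d j * w j = a).card := by
    intro a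
    refine Finset.card_equiv E fun c => ?_
    simp only [Finset.mem_filter, Finset.mem_univ, true_and, Finset.sum_range, hE]
  rw [hcard, hcard]
  -- Shifting the `i`-th digit by `(a' - a) / d i` raises the affine function by `a' - a`.
  refine Finset.card_equiv (Equiv.addRight (Pi.single ⟨i, hi⟩ ((a' - a) / d i))) fun w => ?_
  simp only [Finset.mem_filter, Finset.mem_univ, true_and, Equiv.coe_addRight, Pi.add_apply,
    mul_add, Finset.sum_add_distrib, Pi.single_apply, mul_ite, mul_zero, Finset.sum_ite_eq',
    if_true, mul_div_cancel₀ _ hd]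
  constructor <;> intro h <;> linear_combination h

/-- If all digits below the leading one agree, the difference is constant and only the correction
terms matter; otherwise it is a nonconstant affine function of the digits of `c`. The correction
terms stand on opposite sides to avoid subtraction in `ℕ`. -/
theorem card_gray_sub {p b : ℕ} [Fact p.Prime] (u v : ZMod (p ^ (b + 1))) (a a' : ℕ) :
    (Finset.univ.filter fun c => gray p b u c - gray p b v c = a).card +
      p ^ b * (if u - v = (a' * p ^ b : ℕ) then 1 else 0) =
    (Finset.univ.filter fun c => gray p b u c - gray p b v c = a').card +
      p ^ b * (if u - v = (a * p ^ b : ℕ) then 1 else 0) := by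
  by_cases h : ∀ i < b, digit p u.val i = digit p v.val i
  · obtain ⟨m, rfl⟩ := exists_eq_add_of_digits h
    have hcard : ∀ a : ℕ, (Finset.univ.filter fun c =>
        gray p b (v + (m * p ^ b : ℕ)) c - gray p b v c = a).card =
        p ^ b * (if (m : ZMod p) = a then 1 else 0) := by
      intro a
      simp only [gray_add, add_sub_cancel_left]
      split_ifs with h <;> simp [h]
    simp only [hcard, add_sub_cancel_left, cast_mul_pow_eq_iff]
    ring
  · have hne : ∀ m : ℕ, u - v ≠ (m * p ^ b : ℕ) := by
      intro m hm
      rw [sub_eq_iff_eq_add'] at hm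
      exact h fun i hi => by rw [hm, digit_val_add_of_lt _ _ hi]
    simp only [hne, if_false, mul_zero, add_zero]
    push Not at h
    obtain ⟨i, hi, hne⟩ := h
    have key := card_digits_eq (fun i => digit p u.val i - digit p v.val i)
      (digit p u.val b - digit p v.val b) hi (sub_ne_zero.2 hne) a a'
    have hg : ∀ c : Fin (p ^ b), gray p b u c - gray p b v c =
        digit p u.val b - digit p v.val b +
          ∑ i ∈ Finset.range b, (digit p u.val i - digit p v.val i) * digit p c.val i := by
      intro c
      simp only [gray, sub_mul, Finset.sum_sub_distrib]
      ring
    simpa only [hg] using key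

theorem card_Phi_sub {p s : ℕ} [NeZero p] (α : Fin s → ℕ) (u v : Ambient p α) (a : ZMod p) :
    (Finset.univ.filter fun k => Phi p α u k - Phi p α v k = a).card =
      ∑ b : Fin s, ∑ c : Fin (α b),
        (Finset.univ.filter fun q => gray p b.val (u b c) q - gray p b.val (v b c) q = a).card := by
  let g : (b : Fin s) × Fin (α b * p ^ b.val) → ℕ := fun q =>
    if gray p q.1.val (u q.1 (finProdFinEquiv.symm q.2).1) (finProdFinEquiv.symm q.2).2 -
      gray p q.1.val (v q.1 (finProdFinEquiv.symm q.2).1) (finProdFinEquiv.symm q.2).2 = a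
      then 1 else 0
  rw [Finset.card_filter]
  refine (finSigmaFinEquiv.symm.sum_comp g).trans ?_
  rw [Fintype.sum_sigma]
  refine Finset.sum_congr rfl fun b _ => ?_
  refine (finProdFinEquiv.symm.sum_comp (fun q : Fin (α b) × Fin (p ^ b.val) =>
    if gray p b.val (u b q.1) q.2 - gray p b.val (v b q.1) q.2 = a then 1 else 0)).trans ?_
  simp only [Fintype.sum_prod_type, Finset.card_filter]

/-- The number of coordinates of `w` equal to `a * p ^ b`, counted with multiplicity `p ^ b`. -/
def weight (p : ℕ) {s : ℕ} {α : Fin s → ℕ} (w : Ambient p α) (a : ℕ) : ℕ :=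
  ∑ b : Fin s, p ^ b.val * ∑ c : Fin (α b), if w b c = (a * p ^ b.val : ℕ) then 1 else 0

theorem card_Phi_sub_eq {p s : ℕ} [Fact p.Prime] {α : Fin s → ℕ} {u v : Ambient p α}
    {a a' : ℕ} (h : weight p (u - v) a = weight p (u - v) a') :
    (Finset.univ.filter fun k => Phi p α u k - Phi p α v k = a).card =
      (Finset.univ.filter fun k => Phi p α u k - Phi p α v k = a').card := by
  rw [card_Phi_sub, card_Phi_sub]
  -- After adding the common weight to both sides, the equality holds coordinate by coordinate.
  refine Nat.add_right_cancel (m := weight p (u - v) a') ?_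
  conv_rhs => rw [← h]
  simp only [weight, Finset.mul_sum, ← Finset.sum_add_distrib, Pi.sub_apply]
  exact Finset.sum_congr rfl fun b _ => Finset.sum_congr rfl fun c _ =>
    card_gray_sub (u b c) (v b c) a a'

theorem Phi_add_const {p s : ℕ} [NeZero p] {α : Fin s → ℕ} (u w : Ambient p α) (a : ℕ)
    (hw : ∀ b c, w b c = (a * p ^ b.val : ℕ)) (k : Fin (grayLength p α)) :
    Phi p α (u + w) k = Phi p α u k + a := by
  simp only [Phi, Pi.add_apply, hw, gray_add]

/-! ### Sums over residues modulo a prime power -/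

theorem sum_zmod {n : ℕ} [NeZero n] {M : Type*} [AddCommMonoid M] (f : ZMod n → M) :
    ∑ h : ZMod n, f h = ∑ m ∈ Finset.range n, f m :=
  Finset.sum_nbij' ZMod.val (fun m => (m : ZMod n))
    (fun h _ => Finset.mem_range.2 h.val_lt) (fun _ _ => Finset.mem_univ _)
    (fun h _ => ZMod.natCast_zmod_val h)
    (fun _ hm => ZMod.val_natCast_of_lt (Finset.mem_range.1 hm))
    (fun h _ => by rw [ZMod.natCast_zmod_val])

theorem sum_range_mul_of_mod {G : ℕ → ℕ} {p : ℕ} (h : ∀ n, G n = G (n % p)) (k : ℕ) :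
    ∑ n ∈ Finset.range (k * p), G n = k * ∑ n ∈ Finset.range p, G n := by
  induction k with
  | zero => simp
  | succ k ih =>
    rw [Nat.succ_mul, Finset.sum_range_add, ih, Nat.succ_mul]
    congr 1
    exact Finset.sum_congr rfl fun n _ => by
      rw [h (k * p + n), Nat.mul_add_mod_self_right, ← h]

theorem isUnit_one_add_mul {p b : ℕ} (a : ZMod (p ^ (b + 1))) : IsUnit (1 + p * a) := by
  refine IsNilpotent.isUnit_one_add ⟨b + 1, ?_⟩
  rw [mul_pow, ← Nat.cast_pow, ZMod.natCast_self, zero_mul]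

theorem isUnit_natCast_iff {p b m : ℕ} [Fact p.Prime] :
    IsUnit (m : ZMod (p ^ (b + 1))) ↔ ¬ p ∣ m := by
  rw [ZMod.isUnit_iff_coprime, Nat.coprime_pow_right_iff b.succ_pos, Nat.coprime_comm,
    (Fact.out : p.Prime).coprime_iff_not_dvd]

theorem natCast_mul_natCast_eq_zero_iff {n d m : ℕ} :
    ((d : ℕ) : ZMod n) * (m : ZMod n) = 0 ↔ n ∣ d * m := by
  rw [← Nat.cast_mul, ZMod.natCast_eq_zero_iff]

theorem not_isUnit_iff {p b : ℕ} [Fact p.Prime] (h : ZMod (p ^ (b + 1))) :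
    ¬ IsUnit h ↔ ((p ^ b : ℕ) : ZMod (p ^ (b + 1))) * h = 0 := by
  obtain ⟨m, rfl⟩ := ZMod.natCast_zmod_surjective h
  rw [isUnit_natCast_iff, not_not, natCast_mul_natCast_eq_zero_iff, pow_succ,
    Nat.mul_dvd_mul_iff_left (pow_pos (Fact.out : p.Prime).pos b)]

open Classical in
-- On units `f` depends only on the residue modulo `p`, and each nonzero residue has `p ^ b` lifts.
theorem sum_isUnit {p b : ℕ} [Fact p.Prime] {f : ZMod (p ^ (b + 1)) → ℕ}
    (hf : ∀ a h, f ((1 + p * a) * h) = f h) :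
    p ^ b * ((List.range' 1 (p - 1)).map fun m => f (m : ℕ)).sum =
      ∑ h, if IsUnit h then f h else 0 := by
  have hp : p.Prime := Fact.out
  have hG : ∀ n : ℕ, (if IsUnit (n : ZMod (p ^ (b + 1))) then f n else 0) =
      if IsUnit ((n % p : ℕ) : ZMod (p ^ (b + 1))) then f (n % p : ℕ) else 0 := by
    intro n
    have hiff : IsUnit (n : ZMod (p ^ (b + 1))) ↔
        IsUnit ((n % p : ℕ) : ZMod (p ^ (b + 1))) := by
      rw [isUnit_natCast_iff, isUnit_natCast_iff, Nat.dvd_mod_iff dvd_rfl]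
    by_cases h : IsUnit (n : ZMod (p ^ (b + 1)))
    · have h' := hiff.1 h
      obtain ⟨w, hw⟩ := h'.exists_left_inv
      have hn : (n : ZMod (p ^ (b + 1))) = (n % p : ℕ) + p * (n / p : ℕ) := by
        rw [← Nat.cast_mul, ← Nat.cast_add, Nat.mod_add_div]
      -- With `w` inverse to `n % p`, one has `n = (1 + p * (n / p) * w) * (n % p)`.
      rw [if_pos h, if_pos h', ← hf ((n / p : ℕ) * w) (n % p : ℕ)]
      congr 1
      linear_combination hn - (p : ZMod (p ^ (b + 1))) * (n / p : ℕ) * hw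
    · rw [if_neg h, if_neg (mt hiff.2 h)]
  rw [sum_zmod, show Finset.range (p ^ (b + 1)) = Finset.range (p ^ b * p) by rw [pow_succ],
    sum_range_mul_of_mod hG]
  congr 1
  rw [← List.toFinset_range, List.sum_toFinset _ List.nodup_range]
  obtain ⟨q, rfl⟩ : ∃ q, p = q + 1 := ⟨p - 1, (Nat.sub_add_cancel hp.one_le).symm⟩
  rw [List.range_eq_range', List.range'_succ, List.map_cons, List.sum_cons, if_neg]
  · rw [zero_add, zero_add, Nat.add_sub_cancel]
    congr 1
    refine List.map_congr_left fun m hm => ?_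
    rw [if_pos]
    rw [isUnit_natCast_iff]
    rw [List.mem_range'_1] at hm
    exact Nat.not_dvd_of_pos_of_lt (by omega) (by omega)
  · rw [isUnit_natCast_iff, not_not]
    exact dvd_zero _

theorem list_sum_range {n : ℕ} {M : Type*} [AddCommMonoid M] (f : ℕ → M) :
    ((List.range n).map f).sum = ∑ m ∈ Finset.range n, f m := by
  rw [← List.toFinset_range, List.sum_toFinset _ List.nodup_range]

theorem sum_torsion {p b e : ℕ} [Fact p.Prime] (he : e ≤ b + 1) (f : ZMod (p ^ (b + 1)) → ℕ) :
    ((List.range (p ^ e)).map fun m => f ((p ^ (b + 1 - e) * m : ℕ))).sum =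
      ∑ h, if ((p ^ e : ℕ) : ZMod (p ^ (b + 1))) * h = 0 then f h else 0 := by
  have hp : 0 < p := (Fact.out : p.Prime).pos
  have hpow : p ^ (b + 1) = p ^ e * p ^ (b + 1 - e) := by rw [← pow_add]; congr 1; omega
  rw [list_sum_range, ← Finset.sum_filter]
  have hlt : ∀ m < p ^ e, p ^ (b + 1 - e) * m < p ^ (b + 1) := fun m hm => by
    rw [hpow, mul_comm]
    exact Nat.mul_lt_mul_of_pos_right hm (pow_pos hp _)
  refine Finset.sum_nbij (fun m => ((p ^ (b + 1 - e) * m : ℕ) : ZMod (p ^ (b + 1))))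
    (fun m _ => ?_) (fun m hm n hn h => ?_) (fun h hh => ?_) (fun _ _ => rfl)
  · rw [Finset.mem_filter, natCast_mul_natCast_eq_zero_iff, ← mul_assoc, ← hpow]
    exact ⟨Finset.mem_univ _, dvd_mul_right _ _⟩
  · rw [Finset.mem_coe, Finset.mem_range] at hm hn
    have := congrArg ZMod.val h
    rw [ZMod.val_natCast_of_lt (hlt m hm), ZMod.val_natCast_of_lt (hlt n hn)] at this
    exact Nat.eq_of_mul_eq_mul_left (pow_pos hp _) this
  · have h0 := (Finset.mem_filter.1 (Finset.mem_coe.1 hh)).2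
    rw [← ZMod.natCast_zmod_val h, natCast_mul_natCast_eq_zero_iff] at h0
    obtain ⟨m, hm⟩ := (Nat.mul_dvd_mul_iff_left (pow_pos hp e)).1 (hpow.symm.dvd.trans h0)
    refine ⟨m, ?_, ?_⟩
    · rw [Finset.mem_coe, Finset.mem_range]
      have := h.val_lt.trans_eq hpow
      rw [hm, mul_comm] at this
      exact Nat.lt_of_mul_lt_mul_right this
    · simp only
      rw [← hm, ZMod.natCast_zmod_val]

/-! ### The columns of a block -/

/-- The column entries have orders dividing `p ^ o k`. -/
def IsTorsion {p b r : ℕ} (o : Fin r → ℕ) (g : Fin r → ZMod (p ^ (b + 1))) : Prop :=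
  ∀ k, ((p ^ o k : ℕ) : ZMod (p ^ (b + 1))) * g k = 0

/-- The vector has order exactly `p ^ (b + 1)`; no condition is imposed for `b = 0`. -/
def IsUnimodular {p b r : ℕ} (g : Fin r → ZMod (p ^ (b + 1))) : Prop :=
  b = 0 ∨ ∃ k, IsUnit (g k)

/-- `F` is constant on the orbits of the group of residues congruent to `1` modulo `p`. -/
def IsOrbitInvariant {p b r : ℕ} (F : (Fin r → ZMod (p ^ (b + 1))) → ℕ) : Prop :=
  ∀ a g, F (fun k => (1 + p * a) * g k) = F g

open Classical in
/-- The columns in `L` are the vectors `(p ^ b, g)`, with `g` running over representatives of the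
unimodular torsion vectors modulo the residues congruent to `1` modulo `p`. -/
def Represents (p b : ℕ) [NeZero p] {r : ℕ} (o : Fin r → ℕ)
    (L : List (Fin (r + 1) → ZMod (p ^ (b + 1)))) : Prop :=
  (∀ c ∈ L, c 0 = (p ^ b : ℕ)) ∧
    ∀ F : (Fin r → ZMod (p ^ (b + 1))) → ℕ, IsOrbitInvariant F →
      p ^ b * (L.map fun c => F (Fin.tail c)).sum =
        ∑ g, if IsTorsion o g ∧ IsUnimodular g then F g else 0

theorem tail_snoc {R : Type*} {n : ℕ} (c : Fin (n + 1) → R) (y : R) :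
    Fin.tail (Fin.snoc (α := fun _ => R) c y) = Fin.snoc (α := fun _ => R) (Fin.tail c) y := by
  funext k
  refine Fin.lastCases ?_ (fun k => ?_) k
  · rw [Fin.tail, Fin.succ_last, Fin.snoc_last, Fin.snoc_last]
  · rw [Fin.tail, Fin.succ_castSucc, Fin.snoc_castSucc, Fin.snoc_castSucc, Fin.tail]

theorem mul_snoc {R : Type*} [Mul R] {n : ℕ} (u : R) (c : Fin n → R) (y : R) :
    (fun k => u * Fin.snoc (α := fun _ => R) c y k) =
      Fin.snoc (α := fun _ => R) (fun k => u * c k) (u * y) := by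
  funext k
  refine Fin.lastCases ?_ (fun k => ?_) k <;> simp

theorem sum_snoc {R : Type*} [Fintype R] {n : ℕ} (G : (Fin (n + 1) → R) → ℕ) :
    ∑ g, G g = ∑ g : Fin n → R, ∑ h, G (Fin.snoc (α := fun _ => R) g h) := by
  rw [← (Fin.snocEquiv fun _ => R).sum_comp, Fintype.sum_prod_type_right]
  rfl

theorem list_sum_comm {α β : Type*} (L : List α) (B : List β) (f : α → β → ℕ) :
    (L.map fun m => (B.map fun c => f m c).sum).sum =
      (B.map fun c => (L.map fun m => f m c).sum).sum := by
  induction L with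
  | nil => simp
  | cons a L ih => simp [ih, List.sum_map_add]

theorem sum_map_flatMap {α β : Type*} (L : List α) (B : α → List β) (f : β → ℕ) :
    ((L.flatMap B).map f).sum = (L.map fun a => ((B a).map f).sum).sum := by
  induction L with
  | nil => simp
  | cons a L ih => simp [ih]

theorem sum_map_stack {R : Type} [Semiring R] {n : ℕ} (B : List (Fin (n + 1) → R)) (d : ℕ)
    (L : List ℕ) (F : (Fin (n + 1) → R) → ℕ) :
    ((stack B d L).map fun c => F (Fin.tail c)).sum =
      (L.map fun m => (B.map fun c =>
        F (Fin.snoc (α := fun _ => R) (Fin.tail c) ((d * m : ℕ) : R))).sum).sum := by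
  rw [stack, sum_map_flatMap]
  simp only [List.map_map, Function.comp_def, tail_snoc]

theorem stack_apply_zero {R : Type} [Semiring R] {n : ℕ} {B : List (Fin (n + 1) → R)} {d : ℕ}
    {L : List ℕ} {x : R} (h : ∀ c ∈ B, c 0 = x) : ∀ c ∈ stack B d L, c 0 = x := by
  intro c hc
  simp only [stack, List.mem_flatMap, List.mem_map] at hc
  obtain ⟨m, -, c, hc, rfl⟩ := hc
  rw [← Fin.castSucc_zero, Fin.snoc_castSucc]
  exact h c hc

theorem sum_lexVectors {R : Type} [Fintype R] {L : List R} {P : R → Prop} [DecidablePred P]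
    (hL : ∀ f : R → ℕ, (L.map f).sum = ∑ h, if P h then f h else 0) (n : ℕ)
    (F : (Fin n → R) → ℕ) :
    ((lexVectors L n).map F).sum = ∑ g, if ∀ k, P (g k) then F g else 0 := by
  induction n with
  | zero => simp [lexVectors, Subsingleton.elim _ (Fin.elim0 : Fin 0 → R)]
  | succ n ih =>
    rw [lexVectors, sum_map_flatMap]
    simp only [List.map_map, Function.comp_def, ih, hL]
    rw [← (Fin.consEquiv fun _ => R).sum_comp, Fintype.sum_prod_type]
    refine Finset.sum_congr rfl fun h _ => ?_
    simp only [Fin.consEquiv, Equiv.coe_fn_mk, Fin.forall_fin_succ, Fin.cons_zero, Fin.cons_succ]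
    by_cases hh : P h <;> simp [hh]

/-- Multiplication of vectors by a residue congruent to `1` modulo `p`. -/
noncomputable def scaleEquiv {p b : ℕ} (a : ZMod (p ^ (b + 1))) :
    ZMod (p ^ (b + 1)) ≃ ZMod (p ^ (b + 1)) := (isUnit_one_add_mul a).unit.mulLeft

theorem scaleEquiv_apply {p b : ℕ} (a h : ZMod (p ^ (b + 1))) :
    scaleEquiv a h = (1 + p * a) * h := rfl

theorem isUnit_scale_iff {p b : ℕ} (a h : ZMod (p ^ (b + 1))) :
    IsUnit ((1 + p * a) * h) ↔ IsUnit h := by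
  rw [IsUnit.mul_iff, and_iff_right (isUnit_one_add_mul a)]

theorem mul_scale_eq_zero_iff {p b : ℕ} (d a h : ZMod (p ^ (b + 1))) :
    d * ((1 + p * a) * h) = 0 ↔ d * h = 0 := by
  rw [mul_left_comm, (isUnit_one_add_mul a).mul_right_eq_zero]

open Classical in
-- Scaling permutes the admissible last entries. Thus the sum over a new last entry is again a test
-- function for the old columns.
theorem isOrbitInvariant_sum_snoc {p b r : ℕ} [NeZero p]
    {F : (Fin (r + 1) → ZMod (p ^ (b + 1))) → ℕ}
    (hF : IsOrbitInvariant F) (d : ℕ) :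
    IsOrbitInvariant fun g : Fin r → ZMod (p ^ (b + 1)) =>
      ∑ h, if (d : ZMod (p ^ (b + 1))) * h = 0
        then F (Fin.snoc (α := fun _ => ZMod (p ^ (b + 1))) g h) else 0 := by
  intro a g
  beta_reduce
  rw [← (scaleEquiv a).sum_comp]
  refine Finset.sum_congr rfl fun h _ => ?_
  simp only [scaleEquiv_apply, mul_scale_eq_zero_iff, ← mul_snoc, hF a]

theorem isTorsion_snoc {p b r e : ℕ} {o : Fin r → ℕ} {g : Fin r → ZMod (p ^ (b + 1))}
    {h : ZMod (p ^ (b + 1))} :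
    IsTorsion (Fin.snoc (α := fun _ => ℕ) o e)
      (Fin.snoc (α := fun _ => ZMod (p ^ (b + 1))) g h) ↔
      IsTorsion o g ∧ ((p ^ e : ℕ) : ZMod (p ^ (b + 1))) * h = 0 := by
  simp only [IsTorsion, Fin.forall_fin_succ', Fin.snoc_castSucc, Fin.snoc_last]

theorem isUnimodular_snoc {p b r : ℕ} {g : Fin r → ZMod (p ^ (b + 1))} {h : ZMod (p ^ (b + 1))} :
    IsUnimodular (Fin.snoc (α := fun _ => ZMod (p ^ (b + 1))) g h) ↔
      IsUnimodular g ∨ IsUnit h := by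
  simp only [IsUnimodular, Fin.exists_fin_succ', Fin.snoc_castSucc, Fin.snoc_last, or_assoc]

/-- For `b ≠ 0`, a last entry killed by `p ^ e` with `e ≤ b` is never a unit, so unimodularity is
decided by the old entries, and every old column is combined with every admissible last entry. -/
theorem Represents.stack_torsion {p b r e : ℕ} [Fact p.Prime] {o : Fin r → ℕ}
    {L : List (Fin (r + 1) → ZMod (p ^ (b + 1)))} (hL : Represents p b o L) (he : e ≤ b + 1)
    (hb : b = 0 ∨ e ≤ b) :
    Represents p b (Fin.snoc (α := fun _ => ℕ) o e)
      (stack L (p ^ (b + 1 - e)) (List.range (p ^ e))) := by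
  classical
  refine ⟨stack_apply_zero hL.1, fun F hF => ?_⟩
  rw [sum_map_stack, list_sum_comm]
  have hsum : ∀ g : Fin r → ZMod (p ^ (b + 1)), ((List.range (p ^ e)).map fun m =>
      F (Fin.snoc (α := fun _ => ZMod (p ^ (b + 1))) g
        ((p ^ (b + 1 - e) * m : ℕ) : ZMod (p ^ (b + 1))))).sum =
      ∑ h, if ((p ^ e : ℕ) : ZMod (p ^ (b + 1))) * h = 0 then
        F (Fin.snoc (α := fun _ => ZMod (p ^ (b + 1))) g h) else 0 := fun g =>
    sum_torsion he fun h => F (Fin.snoc (α := fun _ => ZMod (p ^ (b + 1))) g h)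
  simp only [hsum]
  rw [hL.2 _ (isOrbitInvariant_sum_snoc hF _), sum_snoc]
  refine Finset.sum_congr rfl fun g _ => ?_
  have hunit : ∀ h : ZMod (p ^ (b + 1)), ((p ^ e : ℕ) : ZMod (p ^ (b + 1))) * h = 0 →
      IsUnit h → b = 0 := by
    intro h h0 hu
    refine hb.resolve_right fun hle => (not_isUnit_iff h).2 ?_ hu
    obtain ⟨d, hd⟩ := pow_dvd_pow p hle
    rw [hd, Nat.cast_mul, mul_right_comm, h0, zero_mul]
  simp only [isTorsion_snoc, isUnimodular_snoc]
  by_cases hg : IsTorsion o g ∧ IsUnimodular g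
  · simp [hg]
  · rw [if_neg hg]
    refine (Finset.sum_eq_zero fun h _ => if_neg ?_).symm
    rintro ⟨⟨h1, h2⟩, h3⟩
    exact hg ⟨h1, h3.elim id fun hu => Or.inl (hunit h h2 hu)⟩

theorem isTorsion_of_le {p b r : ℕ} {o : Fin r → ℕ} (ho : ∀ k, b + 1 ≤ o k)
    (g : Fin r → ZMod (p ^ (b + 1))) : IsTorsion o g := fun k => by
  rw [(ZMod.natCast_eq_zero_iff _ _).2 (pow_dvd_pow p (ho k)), zero_mul]

/-- A unimodular vector either is unimodular before its last entry, which is then arbitrary (second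
stack), or has only nonunits there and a unit at the end; scaling brings that unit into `1, …, p -
1` (first stack). As `colsM` lists all vectors of nonunits, the old rows must impose no torsion
condition in this block. -/
theorem Represents.append_colsM {p b r e : ℕ} [Fact p.Prime] {o : Fin r → ℕ}
    {L : List (Fin (r + 1) → ZMod (p ^ (b + 1)))} (hL : Represents p b o L) (hb : b ≠ 0)
    (ho : ∀ k, b + 1 ≤ o k) (he : b + 1 ≤ e) :
    Represents p b (Fin.snoc (α := fun _ => ℕ) o e)
      (stack (colsM p r b) 1 (List.range' 1 (p - 1)) ++
        stack L 1 (List.range (p ^ (b + 1)))) := by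
  classical
  constructor
  · intro c hc
    rcases List.mem_append.1 hc with hc | hc
    · refine stack_apply_zero (fun c hc => ?_) c hc
      obtain ⟨z, -, rfl⟩ := List.mem_map.1 hc
      rfl
    · exact stack_apply_zero hL.1 c hc
  · intro F hF
    have hlex : ∀ f : ZMod (p ^ (b + 1)) → ℕ,
        (((List.range (p ^ b)).map fun m => ((p * m : ℕ) : ZMod (p ^ (b + 1)))).map f).sum =
          ∑ h, if ¬ IsUnit h then f h else 0 := by
      intro f
      have := sum_torsion (Nat.le_succ b) f
      rw [Nat.add_sub_cancel_left, pow_one] at this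
      simpa only [not_isUnit_iff, List.map_map, Function.comp_def] using this
    -- Scaling also permutes the vectors of nonunits, so the inner sum is invariant in `h` alone, as
    -- `sum_isUnit` requires.
    have hinv : ∀ a h, (∑ g : Fin r → ZMod (p ^ (b + 1)), if ∀ k, ¬ IsUnit (g k) then
          F (Fin.snoc (α := fun _ => ZMod (p ^ (b + 1))) g ((1 + p * a) * h)) else 0) =
        ∑ g : Fin r → ZMod (p ^ (b + 1)), if ∀ k, ¬ IsUnit (g k) then
          F (Fin.snoc (α := fun _ => ZMod (p ^ (b + 1))) g h) else 0 := by
      intro a h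
      rw [← (Equiv.piCongrRight fun _ : Fin r => scaleEquiv a).sum_comp]
      refine Finset.sum_congr rfl fun g _ => ?_
      rw [show Equiv.piCongrRight (fun _ : Fin r => scaleEquiv a) g =
        fun k => (1 + p * a) * g k from rfl]
      simp only [isUnit_scale_iff, ← mul_snoc, hF a]
    have hcols : ∀ m : ℕ, ((colsM p r b).map fun c =>
        F (Fin.snoc (α := fun _ => ZMod (p ^ (b + 1))) (Fin.tail c)
          ((1 * m : ℕ) : ZMod (p ^ (b + 1))))).sum =
        ∑ g : Fin r → ZMod (p ^ (b + 1)), if ∀ k, ¬ IsUnit (g k) then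
          F (Fin.snoc (α := fun _ => ZMod (p ^ (b + 1))) g m) else 0 := by
      intro m
      rw [colsM, List.map_map, one_mul]
      exact sum_lexVectors hlex r fun g => F (Fin.snoc (α := fun _ => ZMod (p ^ (b + 1))) g m)
    -- The vacuous condition `0 * h = 0` puts the full sum in the form of
    -- `isOrbitInvariant_sum_snoc`.
    have h2 : ∀ g : Fin r → ZMod (p ^ (b + 1)), ((List.range (p ^ (b + 1))).map fun m =>
        F (Fin.snoc (α := fun _ => ZMod (p ^ (b + 1))) g ((1 * m : ℕ) : ZMod (p ^ (b + 1))))).sum =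
        ∑ h, if ((0 : ℕ) : ZMod (p ^ (b + 1))) * h = 0 then
          F (Fin.snoc (α := fun _ => ZMod (p ^ (b + 1))) g h) else 0 := by
      intro g
      simp only [Nat.cast_zero, zero_mul, if_true, one_mul]
      rw [list_sum_range, sum_zmod]
    rw [List.map_append, List.sum_append, mul_add, sum_map_stack, sum_map_stack]
    simp only [hcols]
    rw [sum_isUnit (f := fun h => ∑ g : Fin r → ZMod (p ^ (b + 1)), if ∀ k, ¬ IsUnit (g k) then
      F (Fin.snoc (α := fun _ => ZMod (p ^ (b + 1))) g h) else 0) hinv, list_sum_comm]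
    simp only [h2]
    rw [hL.2 _ (isOrbitInvariant_sum_snoc hF _), sum_snoc]
    have hswap : ∀ h : ZMod (p ^ (b + 1)), (if IsUnit h then
        ∑ g : Fin r → ZMod (p ^ (b + 1)), if ∀ k, ¬ IsUnit (g k) then
          F (Fin.snoc (α := fun _ => ZMod (p ^ (b + 1))) g h) else 0 else 0) =
        ∑ g : Fin r → ZMod (p ^ (b + 1)), if IsUnit h ∧ ∀ k, ¬ IsUnit (g k) then
          F (Fin.snoc (α := fun _ => ZMod (p ^ (b + 1))) g h) else 0 := by
      intro h
      by_cases hh : IsUnit h <;> simp [hh]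
    simp only [hswap]
    rw [Finset.sum_comm, ← Finset.sum_add_distrib]
    refine Finset.sum_congr rfl fun g _ => ?_
    have hbe : ((p ^ e : ℕ) : ZMod (p ^ (b + 1))) = 0 :=
      (ZMod.natCast_eq_zero_iff _ _).2 (pow_dvd_pow p he)
    simp only [isTorsion_snoc, isTorsion_of_le ho, isUnimodular_snoc, hbe, zero_mul, Nat.cast_zero,
      true_and, if_true]
    by_cases hg : ∃ k, IsUnit (g k)
    · have hg' : ¬ ∀ k, ¬ IsUnit (g k) := fun h => hg.elim h
      have hu : IsUnimodular g := Or.inr hg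
      simp only [hg', hu, and_false, if_false, Finset.sum_const_zero, true_or, if_true, zero_add]
    · have hu : ¬ IsUnimodular g := not_or.2 ⟨hb, hg⟩
      simp only [not_exists.1 hg, hu, if_false, false_or, add_zero, not_false_iff, implies_true,
        and_true]

theorem Represents.congr {p b r : ℕ} [NeZero p] {o o' : Fin r → ℕ}
    {L : List (Fin (r + 1) → ZMod (p ^ (b + 1)))} (hL : Represents p b o L)
    (h : ∀ g : Fin r → ZMod (p ^ (b + 1)), IsTorsion o g ↔ IsTorsion o' g) :
    Represents p b o' L := by
  refine ⟨hL.1, fun F hF => ?_⟩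
  classical
  rw [hL.2 F hF]
  exact Finset.sum_congr rfl fun g _ => if_congr (and_congr_left' (h g)) rfl rfl

theorem sum_fin_one {R : Type*} [Fintype R] (G : (Fin 1 → R) → ℕ) :
    ∑ g, G g = ∑ h, G fun _ => h :=
  ((Equiv.funUnique (Fin 1) R).symm.sum_comp G).symm

theorem baseMatrix_cols {p s : ℕ} (b : Fin s) :
    (baseMatrix p s).cols b =
      (if b.val = 0 then List.range p else List.range' 1 (p - 1)).map fun m : ℕ =>
        ![((p ^ b.val : ℕ) : ZMod (p ^ (b.val + 1))), (m : ZMod (p ^ (b.val + 1)))] := by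
  unfold baseMatrix
  split_ifs with h <;> simp [h, List.flatMap_assoc, List.map_eq_flatMap]

theorem represents_base {p s : ℕ} [Fact p.Prime] (b : Fin s) :
    Represents p b.val (fun _ : Fin 1 => s) ((baseMatrix p s).cols b) := by
  classical
  rw [baseMatrix_cols]
  constructor
  · intro c hc
    obtain ⟨m, -, rfl⟩ := List.mem_map.1 hc
    rfl
  · intro F hF
    have htail : ∀ m : ℕ, Fin.tail ![((p ^ b.val : ℕ) : ZMod (p ^ (b.val + 1))),
        (m : ZMod (p ^ (b.val + 1)))] = fun _ : Fin 1 => (m : ZMod (p ^ (b.val + 1))) := by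
      intro m
      funext k
      fin_cases k
      rfl
    rw [sum_fin_one]
    simp only [List.map_map, Function.comp_def, htail,
      isTorsion_of_le (o := fun _ : Fin 1 => s) fun _ => b.isLt, true_and, IsUnimodular,
      exists_const]
    by_cases hb : b.val = 0
    · simp only [hb, true_or, if_true]
      rw [sum_zmod, list_sum_range, pow_zero, one_mul]
      refine Finset.sum_congr ?_ fun _ _ => rfl
      rw [hb, zero_add, pow_one]
    · simp only [hb, if_false, false_or]
      exact sum_isUnit (f := fun h => F fun _ => h) fun a h => hF a fun _ => h

/-! ### The rows of the generator matrix -/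

/-- `ι k` is the index of the type component to which row `k` contributes: row `k` has order
`p ^ (s - ι k)`. -/
structure Presents {p s : ℕ} [NeZero p] (A : BlockMatrix p s) (ι : Fin (A.r + 1) → Fin s) :
    Prop where
  pos : 0 < A.r
  zero : (ι 0).val = s - 1
  represents : ∀ b, Represents p b.val (fun k : Fin A.r => s - (ι k.succ).val) (A.cols b)

/-- The two initial rows have orders `p` and `p ^ s`; they account for the ones subtracted in
`steps`. -/
theorem presents_base {p s : ℕ} [Fact p.Prime] (i j : Fin s) (hi : i.val = s - 1)
    (hj : j.val = 0) : Presents (baseMatrix p s) ![i, j] := by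
  refine ⟨Nat.one_pos, hi, fun b => ?_⟩
  have ho : (fun k : Fin 1 => s - (![i, j] k.succ).val) = fun _ => s := by
    funext k
    fin_cases k
    simp [hj]
  have key := represents_base (p := p) b
  rw [← ho] at key
  exact key

/-- Since orders do not increase after row `0`, the old rows are unrestricted modulo `p ^ (b + 1)`
in every block `P_b`; `hi` is needed only there. -/
theorem Presents.addRow {p s : ℕ} [Fact p.Prime] {A : BlockMatrix p s}
    {ι : Fin (A.r + 1) → Fin s} (hA : Presents A ι) {i : Fin s}
    (hi : ∀ k : Fin A.r, ι k.succ ≤ i) :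
    Presents (addRow A i) (Fin.snoc (α := fun _ => Fin s) ι i) := by
  refine ⟨Nat.succ_pos _, ?_, fun b => ?_⟩
  · exact (congrArg Fin.val (Fin.snoc_castSucc (α := fun _ => Fin s) i ι 0)).trans hA.zero
  · have ho : (fun k : Fin (A.r + 1) =>
        s - (Fin.snoc (α := fun _ => Fin s) ι i k.succ).val) =
        Fin.snoc (α := fun _ => ℕ) (fun k : Fin A.r => s - (ι k.succ).val) (s - i.val) := by
      funext k
      refine Fin.lastCases ?_ (fun k => ?_) k
      · rw [Fin.succ_last, Fin.snoc_last, Fin.snoc_last]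
      · rw [Fin.succ_castSucc, Fin.snoc_castSucc, Fin.snoc_castSucc]
    have key : Represents p b.val
        (Fin.snoc (α := fun _ => ℕ) (fun k : Fin A.r => s - (ι k.succ).val) (s - i.val))
        (if b.val = 0 then stack (A.cols b) 1 (List.range p)
          else if b.val ≤ s - (i.val + 1) then
            stack (colsM p A.r b.val) 1 (List.range' 1 (p - 1)) ++
              stack (A.cols b) 1 (List.range (p ^ (b.val + 1)))
          else stack (A.cols b) (p ^ (b.val - (s - (i.val + 1))))
            (List.range (p ^ (s - i.val)))) := by
      have hi' : ∀ k : Fin A.r, (ι k.succ).val ≤ i.val := hi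
      have hs := i.isLt
      split_ifs with h0 h1
      -- Modulo `p` all positive exponents impose the same empty condition, so `e = 1` may replace
      -- `s - i`.
      · have h := (hA.represents b).stack_torsion (e := 1) (by omega) (Or.inl h0)
        rw [Nat.add_sub_cancel, show p ^ b.val = 1 by rw [h0, pow_zero], pow_one] at h
        refine h.congr fun g => iff_of_true (isTorsion_of_le ?_ g) (isTorsion_of_le ?_ g)
        all_goals
          intro k
          refine Fin.lastCases ?_ (fun k => ?_) k
          · rw [Fin.snoc_last]
            omega
          · rw [Fin.snoc_castSucc]
            have := (ι k.succ).isLt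
            omega
      · refine (hA.represents b).append_colsM h0 (fun k => ?_) (by omega)
        have := hi' k
        omega
      · rw [show b.val - (s - (i.val + 1)) = b.val + 1 - (s - i.val) by omega]
        exact (hA.represents b).stack_torsion (by omega) (Or.inr (by omega))
    rw [← ho] at key
    exact key

theorem card_filter_snoc {ι : Type*} [DecidableEq ι] {n : ℕ} (f : Fin n → ι) (i j : ι) :
    (Finset.univ.filter fun k => Fin.snoc (α := fun _ => ι) f i k = j).card =
      (Finset.univ.filter fun k => f k = j).card + if i = j then 1 else 0 := by
  simp only [Finset.card_filter, Fin.sum_univ_castSucc, Fin.snoc_castSucc, Fin.snoc_last]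

theorem exists_presents_foldl {p s : ℕ} [Fact p.Prime] {l : List (Fin s)}
    (hl : l.Pairwise (· ≤ ·)) {A : BlockMatrix p s} {ι : Fin (A.r + 1) → Fin s}
    (hA : Presents A ι) (hι : ∀ i ∈ l, ∀ k : Fin A.r, ι k.succ ≤ i) :
    ∃ ι' : Fin ((l.foldl addRow A).r + 1) → Fin s, Presents (l.foldl addRow A) ι' ∧
      ∀ j, (Finset.univ.filter fun k => ι' k = j).card =
        (Finset.univ.filter fun k => ι k = j).card + l.count j := by
  induction l generalizing A with
  | nil => exact ⟨ι, hA, fun j => rfl⟩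
  | cons i l ih =>
    rw [List.pairwise_cons] at hl
    have hι' : ∀ j ∈ l, ∀ k : Fin (A.r + 1),
        Fin.snoc (α := fun _ => Fin s) ι i k.succ ≤ j := by
      intro j hj k
      refine Fin.lastCases ?_ (fun k => ?_) k
      · rw [Fin.succ_last, Fin.snoc_last]
        exact hl.1 j hj
      · rw [Fin.succ_castSucc, Fin.snoc_castSucc]
        exact hι j (List.mem_cons_of_mem _ hj) k
    obtain ⟨ι', h, hc⟩ := ih hl.2 (hA.addRow (hι i List.mem_cons_self)) hι'
    refine ⟨ι', h, fun j => (hc j).trans ?_⟩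
    rw [List.count_cons, add_comm (l.count j), ← add_assoc]
    simp only [beq_iff_eq]
    exact congrArg (· + l.count j) (card_filter_snoc ι i j)

theorem pairwise_steps {s : ℕ} (t : Fin s → ℕ) : (steps t).Pairwise (· ≤ ·) := by
  rw [steps, List.pairwise_flatMap]
  constructor
  · intro i _
    exact List.pairwise_replicate.2 (Or.inr le_rfl)
  · refine (List.pairwise_lt_finRange s).imp fun {i j} hij x hx y hy => ?_
    rw [List.eq_of_mem_replicate hx, List.eq_of_mem_replicate hy]
    exact hij.le

theorem count_steps {s : ℕ} (t : Fin s → ℕ) (j : Fin s) :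
    (steps t).count j = if j.val = 0 ∨ j.val = s - 1 then t j - 1 else t j := by
  rw [steps, List.count_flatMap]
  simp only [Function.comp_def, List.count_replicate, beq_iff_eq]
  rw [← Fin.sum_univ_def, Finset.sum_ite_eq']
  simp

theorem exists_presents_genMatrix {p n : ℕ} [Fact p.Prime] (hn : 1 ≤ n) (t : Fin (n + 1) → ℕ)
    (h0 : 1 ≤ t 0) (h1 : 1 ≤ t (Fin.last n)) :
    ∃ ι, Presents (genMatrix p t) ι ∧
      ∀ j, (Finset.univ.filter fun k => ι k = j).card = t j := by
  obtain ⟨ι, h, hc⟩ := exists_presents_foldl (pairwise_steps t)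
    (presents_base (p := p) (Fin.last n) 0 rfl rfl) (fun i _ k => by
      have : k = (0 : Fin 1) := Subsingleton.elim (α := Fin 1) _ _
      subst this
      exact Fin.zero_le i)
  refine ⟨ι, h, fun j => (hc j).trans ?_⟩
  rw [count_steps, Finset.card_filter]
  refine (congrArg (· + _) (Fin.sum_univ_two
    (f := fun k : Fin 2 => if ![Fin.last n, 0] k = j then 1 else 0))).trans ?_
  simp only [Matrix.cons_val_zero, Matrix.cons_val_one, Fin.ext_iff, Fin.val_last, Fin.val_zero]
  have hn0 : n ≠ 0 := Nat.one_le_iff_ne_zero.1 hn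
  by_cases hj0 : j.val = 0
  · have : j = 0 := Fin.ext hj0
    subst this
    simp [hn0]
    omega
  · by_cases hj1 : j.val = n
    · have : j = Fin.last n := Fin.ext hj1
      subst this
      simp [hn0.symm]
      omega
    · simp [hj0, hj1, Ne.symm hj0, Ne.symm hj1]

/-! ### Summation over all orders -/

/-- Multiplication by `p`, as an embedding of the integers modulo `p ^ (b + 1)` into those modulo
`p ^ (b + 2)`. -/
def lift (p b : ℕ) : ZMod (p ^ (b + 1)) →+ ZMod (p ^ (b + 2)) :=
  ZMod.lift (p ^ (b + 1)) ⟨(zmultiplesHom (ZMod (p ^ (b + 2)))) p, by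
    rw [zmultiplesHom_apply, natCast_zsmul, nsmul_eq_mul, ← Nat.cast_mul, ← pow_succ,
      ZMod.natCast_self]⟩

theorem lift_natCast (p b m : ℕ) :
    lift p b (m : ZMod (p ^ (b + 1))) = ((m * p : ℕ) : ZMod (p ^ (b + 2))) := by
  have := ZMod.lift_coe (p ^ (b + 1)) ⟨(zmultiplesHom (ZMod (p ^ (b + 2)))) p, by
    rw [zmultiplesHom_apply, natCast_zsmul, nsmul_eq_mul, ← Nat.cast_mul, ← pow_succ,
      ZMod.natCast_self]⟩ (m : ℤ)
  rw [Int.cast_natCast] at this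
  rw [lift, this]
  simp

theorem lift_injective (p b : ℕ) [NeZero p] : Function.Injective (lift p b) := by
  rw [injective_iff_map_eq_zero]
  intro x hx
  obtain ⟨m, rfl⟩ := ZMod.natCast_zmod_surjective x
  rw [lift_natCast, ZMod.natCast_eq_zero_iff, pow_succ,
    Nat.mul_dvd_mul_iff_right (Nat.pos_of_ne_zero (NeZero.ne p))] at hx
  exact (ZMod.natCast_eq_zero_iff _ _).2 hx

theorem lift_natCast_mul (p b m : ℕ) (x : ZMod (p ^ (b + 1))) :
    lift p b (m * x) = m * lift p b x := by
  rw [← nsmul_eq_mul, map_nsmul, nsmul_eq_mul]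

theorem lift_intCast_mul (p b : ℕ) (m : ℤ) (x : ZMod (p ^ (b + 1))) :
    lift p b (m * x) = m * lift p b x := by
  rw [← zsmul_eq_mul, map_zsmul, zsmul_eq_mul]

theorem exists_lift_eq_iff {p b : ℕ} [Fact p.Prime] (h : ZMod (p ^ (b + 2))) :
    (∃ x, lift p b x = h) ↔ ¬ IsUnit h := by
  obtain ⟨m, rfl⟩ := ZMod.natCast_zmod_surjective h
  rw [isUnit_natCast_iff (b := b + 1), not_not]
  constructor
  · rintro ⟨x, hx⟩
    obtain ⟨k, rfl⟩ := ZMod.natCast_zmod_surjective x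
    rw [lift_natCast, ZMod.natCast_eq_natCast_iff] at hx
    exact ((hx.of_dvd (dvd_pow_self p (Nat.succ_ne_zero _))).dvd_iff dvd_rfl).1
      (Dvd.intro_left k rfl)
  · rintro ⟨k, rfl⟩
    exact ⟨k, by rw [lift_natCast, mul_comm]⟩

theorem isTorsion_lift {p b r : ℕ} [NeZero p] {o : Fin r → ℕ} {g : Fin r → ZMod (p ^ (b + 1))} :
    IsTorsion (b := b + 1) o (fun k => lift p b (g k)) ↔ IsTorsion o g := by
  refine forall_congr' fun k => ?_
  rw [← lift_natCast_mul, map_eq_zero_iff _ (lift_injective p b)]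

open Classical in
-- In the induction step, the non-unimodular torsion vectors modulo `p ^ (n + 2)` are exactly the
-- lifts of the torsion vectors modulo `p ^ (n + 1)`.
theorem sum_unimodular {p r : ℕ} [Fact p.Prime] {o : Fin r → ℕ}
    {F : (b : ℕ) → (Fin r → ZMod (p ^ (b + 1))) → ℕ}
    (hF : ∀ b g, F (b + 1) (fun k => lift p b (g k)) = F b g) (n : ℕ) :
    ∑ b ∈ Finset.range (n + 1), ∑ g : Fin r → ZMod (p ^ (b + 1)),
      (if IsTorsion o g ∧ IsUnimodular g then F b g else 0) =
    ∑ g : Fin r → ZMod (p ^ (n + 1)), if IsTorsion o g then F n g else 0 := by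
  induction n with
  | zero => simp [IsUnimodular]
  | succ n ih =>
    rw [Finset.sum_range_succ, ih]
    have hsplit : ∀ g : Fin r → ZMod (p ^ (n + 1 + 1)), (if IsTorsion o g then F (n + 1) g else 0) =
        (if IsTorsion o g ∧ ¬ IsUnimodular g then F (n + 1) g else 0) +
          if IsTorsion o g ∧ IsUnimodular g then F (n + 1) g else 0 := by
      intro g
      by_cases h : IsTorsion o g <;> by_cases h' : IsUnimodular g <;> simp [h, h']
    simp only [hsplit]
    rw [Finset.sum_add_distrib]
    congr 1
    rw [← Finset.sum_filter, ← Finset.sum_filter]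
    refine Finset.sum_nbij (fun g k => lift p n (g k)) (fun g hg => ?_) (fun g _ g' _ h => ?_)
      (fun g hg => ?_) (fun g _ => (hF n g).symm)
    · rw [Finset.mem_filter] at hg ⊢
      refine ⟨Finset.mem_univ _, isTorsion_lift.2 hg.2, ?_⟩
      rintro (h | ⟨k, hk⟩)
      · exact Nat.succ_ne_zero n h
      · exact (exists_lift_eq_iff _).1 ⟨_, rfl⟩ hk
    · exact funext fun k => lift_injective p n (congrFun h k)
    · obtain ⟨-, h1, h2⟩ := Finset.mem_filter.1 (Finset.mem_coe.1 hg)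
      have hex : ∀ k, ∃ x, lift p n x = g k := fun k =>
        (exists_lift_eq_iff _).2 fun hk => h2 (Or.inr ⟨k, hk⟩)
      choose x hx using hex
      obtain rfl : (fun k => lift p n (x k)) = g := funext hx
      exact ⟨x, Finset.mem_coe.2 (Finset.mem_filter.2 ⟨Finset.mem_univ _, isTorsion_lift.1 h1⟩), rfl⟩

/-- The columns of a block matrix. -/
def BlockMatrix.col {p s : ℕ} (A : BlockMatrix p s) (b : Fin s) (c : Fin (A.alpha b)) :
    Fin (A.r + 1) → ZMod (p ^ (b.val + 1)) := fun k => A.row k b c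

theorem BlockMatrix.col_mem {p s : ℕ} (A : BlockMatrix p s) (b : Fin s) (c : Fin (A.alpha b)) :
    A.col b c ∈ A.cols b := List.get_mem (A.cols b) c

open Classical in
theorem Presents.sum_cols {p n : ℕ} [Fact p.Prime] {A : BlockMatrix p (n + 1)}
    {ι : Fin (A.r + 1) → Fin (n + 1)} (hA : Presents A ι)
    {F : (b : ℕ) → (Fin A.r → ZMod (p ^ (b + 1))) → ℕ} (hinv : ∀ b, IsOrbitInvariant (F b))
    (hF : ∀ b g, F (b + 1) (fun k => lift p b (g k)) = F b g) :
    ∑ b : Fin (n + 1), p ^ b.val * ∑ c : Fin (A.alpha b), F b.val (Fin.tail (A.col b c)) =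
      ∑ g : Fin A.r → ZMod (p ^ (n + 1)),
        if IsTorsion (fun k => n + 1 - (ι k.succ).val) g then F n g else 0 := by
  rw [← sum_unimodular hF, Finset.sum_range]
  refine Finset.sum_congr rfl fun b _ => ?_
  rw [← (hA.represents b).2 (F b.val) (hinv b.val)]
  congr 1
  rw [← List.sum_ofFn]
  congr 1
  conv_rhs => rw [← List.ofFn_get (A.cols b), List.map_ofFn]
  rfl

/-! ### Codewords -/

theorem row_zero {p n : ℕ} [NeZero p] {A : BlockMatrix p (n + 1)}
    {ι : Fin (A.r + 1) → Fin (n + 1)} (hA : Presents A ι) (b : Fin (n + 1))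
    (c : Fin (A.alpha b)) : A.row 0 b c = (p ^ b.val : ℕ) :=
  (hA.represents b).1 _ (A.col_mem b c)

open Classical in
theorem card_torsion {p n e : ℕ} [Fact p.Prime] (he : e ≤ n + 1) :
    (Finset.univ.filter fun h : ZMod (p ^ (n + 1)) =>
      ((p ^ e : ℕ) : ZMod (p ^ (n + 1))) * h = 0).card = p ^ e := by
  rw [Finset.card_filter, ← sum_torsion he fun _ => 1]
  simp

/-- The constant test function `1` shows that the length is the order of the torsion group. -/
theorem Presents.grayLength_eq {p n : ℕ} [Fact p.Prime] {A : BlockMatrix p (n + 1)}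
    {ι : Fin (A.r + 1) → Fin (n + 1)} (hA : Presents A ι) :
    grayLength p A.alpha = ∏ k : Fin A.r, p ^ (n + 1 - (ι k.succ).val) := by
  classical
  have h := hA.sum_cols (F := fun _ _ => 1) (fun _ _ _ => rfl) (fun _ _ => rfl)
  simp only [Finset.sum_const, Finset.card_univ, Fintype.card_fin, smul_eq_mul, mul_one] at h
  rw [grayLength, Finset.sum_congr rfl fun b _ => mul_comm (A.alpha b) (p ^ b.val), h,
    ← Finset.card_filter]
  have hpi : (Finset.univ.filter fun g : Fin A.r → ZMod (p ^ (n + 1)) =>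
      IsTorsion (fun k => n + 1 - (ι k.succ).val) g) =
      Fintype.piFinset fun k => Finset.univ.filter fun h : ZMod (p ^ (n + 1)) =>
        ((p ^ (n + 1 - (ι k.succ).val) : ℕ) : ZMod (p ^ (n + 1))) * h = 0 := by
    ext g
    simp [IsTorsion, Fintype.mem_piFinset]
  rw [hpi, Fintype.card_piFinset]
  exact Finset.prod_congr rfl fun k _ => card_torsion (Nat.sub_le _ _)

theorem Presents.grayLength_pos {p n : ℕ} [Fact p.Prime] {A : BlockMatrix p (n + 1)}
    {ι : Fin (A.r + 1) → Fin (n + 1)} (hA : Presents A ι) : 0 < grayLength p A.alpha := by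
  rw [hA.grayLength_eq]
  exact Finset.prod_pos fun k _ => pow_pos (Fact.out : p.Prime).pos _

/-- For `b = 0` the zero vector is counted. A coordinate in this block lets the coefficient of row
`0` be read off modulo `p`. -/
theorem Represents.ne_nil {p r : ℕ} [NeZero p] {o : Fin r → ℕ}
    {L : List (Fin (r + 1) → ZMod (p ^ (0 + 1)))} (hL : Represents p 0 o L) : L ≠ [] := by
  classical
  rintro rfl
  have h := hL.2 (fun _ => 1) fun _ _ => rfl
  rw [List.map_nil, List.sum_nil, mul_zero] at h
  have h0 := Finset.sum_eq_zero_iff.1 h.symm 0 (Finset.mem_univ _)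
  rw [if_pos ⟨fun k => mul_zero _, Or.inl rfl⟩] at h0
  exact one_ne_zero h0

/-- Tested on the indicator of the non-torsion vectors, the right-hand side of `Represents`
vanishes, so no column contributes. -/
theorem Represents.isTorsion_tail {p b r : ℕ} [NeZero p] {o : Fin r → ℕ}
    {L : List (Fin (r + 1) → ZMod (p ^ (b + 1)))} (hL : Represents p b o L)
    {c : Fin (r + 1) → ZMod (p ^ (b + 1))} (hc : c ∈ L) : IsTorsion o (Fin.tail c) := by
  classical
  have h := hL.2 (fun g => if IsTorsion o g then 0 else 1) fun a g =>
    if_congr (forall_congr' fun k => by rw [mul_scale_eq_zero_iff]) rfl rfl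
  rw [Finset.sum_eq_zero fun g _ => by by_cases hg : IsTorsion o g <;> simp [hg]] at h
  have h0 := (mul_eq_zero.1 h).resolve_left (pow_ne_zero b (NeZero.ne p))
  have h1 := List.sum_eq_zero_iff.1 h0 _ (List.mem_map_of_mem hc)
  by_contra hn
  rw [if_neg hn] at h1
  exact one_ne_zero h1

/-- The integral combination of the rows with coefficients `x`. -/
def BlockMatrix.comb {p s : ℕ} (A : BlockMatrix p s) :
    (Fin (A.r + 1) → ℤ) →+ Ambient p A.alpha where
  toFun x := ∑ k, x k • A.row k
  map_zero' := by simp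
  map_add' x y := by simp [add_smul, Finset.sum_add_distrib]

theorem comb_apply {p s : ℕ} (A : BlockMatrix p s) (x : Fin (A.r + 1) → ℤ) (b : Fin s)
    (c : Fin (A.alpha b)) :
    A.comb x b c = x 0 * A.col b c 0 +
      ∑ k : Fin A.r, x k.succ * Fin.tail (A.col b c) k := by
  simp only [BlockMatrix.comb, AddMonoidHom.coe_mk, ZeroHom.coe_mk, Finset.sum_apply,
    Pi.smul_apply]
  simp only [zsmul_eq_mul, Fin.sum_univ_succ]
  rfl

theorem range_comb {p s : ℕ} (A : BlockMatrix p s) : A.comb.range = A.code := by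
  apply le_antisymm
  · rintro _ ⟨x, rfl⟩
    change ∑ k, x k • A.row k ∈ A.code
    exact A.code.sum_mem fun k _ => A.code.zsmul_mem
      (AddSubgroup.subset_closure (Set.mem_range_self k)) _
  · rw [BlockMatrix.code, AddSubgroup.closure_le]
    rintro _ ⟨k, rfl⟩
    refine ⟨Pi.single k 1, ?_⟩
    simp [BlockMatrix.comb, Pi.single_apply]

/-- The indicator function used to count the coordinates equal to `a * p ^ b`. -/
def hitIndicator (p : ℕ) {r : ℕ} (x : Fin (r + 1) → ℤ) (a b : ℕ)
    (g : Fin r → ZMod (p ^ (b + 1))) : ℕ :=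
  if x 0 * ((p ^ b : ℕ) : ZMod (p ^ (b + 1))) + ∑ k : Fin r, x k.succ * g k =
    ((a * p ^ b : ℕ) : ZMod (p ^ (b + 1))) then 1 else 0

/-- Residues congruent to `1` modulo `p` fix all multiples of `p ^ b`, hence both the contribution
of row `0` and the target value. -/
theorem isOrbitInvariant_hitIndicator {p r : ℕ} (x : Fin (r + 1) → ℤ) (a b : ℕ) :
    IsOrbitInvariant (hitIndicator p x a b) := by
  intro c g
  unfold hitIndicator
  have hsum : ∑ k : Fin r, (x k.succ : ZMod (p ^ (b + 1))) * ((1 + p * c) * g k) =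
      (1 + p * c) * ∑ k : Fin r, x k.succ * g k := by
    rw [Finset.mul_sum]
    exact Finset.sum_congr rfl fun k _ => mul_left_comm _ _ _
  have hp : ((p ^ b : ℕ) : ZMod (p ^ (b + 1))) * p = 0 := by
    rw [← Nat.cast_mul, ← pow_succ, ZMod.natCast_self]
  rw [hsum, Nat.cast_mul]
  generalize ∑ k : Fin r, (x k.succ : ZMod (p ^ (b + 1))) * g k = S
  refine if_congr ?_ rfl rfl
  generalize ((p ^ b : ℕ) : ZMod (p ^ (b + 1))) = q at hp ⊢
  constructor
  · intro h
    refine (isUnit_one_add_mul c).mul_left_cancel ?_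
    linear_combination h + (x 0 - a) * c * hp
  · intro h
    linear_combination (1 + p * c) * h - (x 0 - a) * c * hp

theorem hitIndicator_lift {p r : ℕ} [NeZero p] (x : Fin (r + 1) → ℤ) (a b : ℕ)
    (g : Fin r → ZMod (p ^ (b + 1))) :
    hitIndicator p x a (b + 1) (fun k => lift p b (g k)) = hitIndicator p x a b g := by
  unfold hitIndicator
  refine if_congr ?_ rfl rfl
  rw [← (lift_injective p b).eq_iff, map_add, map_sum, lift_intCast_mul, lift_natCast,
    lift_natCast, mul_assoc, ← pow_succ]
  simp only [lift_intCast_mul]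

open Classical in
theorem Presents.weight_comb {p n : ℕ} [Fact p.Prime] {A : BlockMatrix p (n + 1)}
    {ι : Fin (A.r + 1) → Fin (n + 1)} (hA : Presents A ι) (x : Fin (A.r + 1) → ℤ) (a : ℕ) :
    weight p (A.comb x) a = ∑ g : Fin A.r → ZMod (p ^ (n + 1)),
      if IsTorsion (fun k => n + 1 - (ι k.succ).val) g then hitIndicator p x a n g else 0 := by
  rw [← hA.sum_cols (F := hitIndicator p x a) (isOrbitInvariant_hitIndicator x a)
    (hitIndicator_lift x a)]
  refine Finset.sum_congr rfl fun b _ => ?_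
  congr 1
  refine Finset.sum_congr rfl fun c _ => ?_
  rw [comb_apply, hitIndicator, (hA.represents b).1 _ (A.col_mem b c)]

theorem exists_torsion_mul_eq {p n e : ℕ} [Fact p.Prime] (he : e ≤ n + 1) {y : ℤ}
    (hy : ¬ ((p ^ e : ℕ) : ℤ) ∣ y) :
    ∃ h : ZMod (p ^ (n + 1)), ((p ^ e : ℕ) : ZMod (p ^ (n + 1))) * h = 0 ∧
      y * h = (p ^ n : ℕ) := by
  have hdvd : Int.gcd y (p ^ (n + 1) : ℕ) ∣ p ^ (n + 1) := by
    exact_mod_cast Int.gcd_dvd_right y (p ^ (n + 1) : ℕ)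
  obtain ⟨v, hv, hgcd⟩ := (Nat.dvd_prime_pow Fact.out).1 hdvd
  have hve : v < e := by
    by_contra! h
    refine hy (dvd_trans ?_ (Int.gcd_dvd_left y (p ^ (n + 1) : ℕ)))
    rw [hgcd]
    exact_mod_cast pow_dvd_pow p h
  have hbez := congrArg (Int.cast : ℤ → ZMod (p ^ (n + 1)))
    (Int.gcd_eq_gcd_ab y (p ^ (n + 1) : ℕ))
  rw [hgcd, Int.cast_natCast, Int.cast_add, Int.cast_mul, Int.cast_mul, Int.cast_natCast,
    ZMod.natCast_self, zero_mul, add_zero] at hbez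
  -- Here `p ^ v` is the gcd of `y` and `p ^ (n + 1)`, so `y` times its Bézout coefficient is `p ^
  -- v`. The factor `p ^ (n - v)` raises this to `p ^ n`, and `v < e` makes the product torsion.
  refine ⟨(p ^ (n - v) : ℕ) * (Int.gcdA y (p ^ (n + 1) : ℕ) : ℤ), ?_, ?_⟩
  · rw [← mul_assoc, ← Nat.cast_mul, ← pow_add,
      (ZMod.natCast_eq_zero_iff _ _).2 (pow_dvd_pow p (by omega)), zero_mul]
  · rw [mul_left_comm, ← hbez, ← Nat.cast_mul, ← pow_add]
    congr 2
    omega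

/-- Translating `g k` by `(a' - a) * h`, with `h` torsion and `x k.succ * h = p ^ n`, carries the
solutions for `a` to those for `a'`. -/
theorem Presents.weight_comb_eq {p n : ℕ} [Fact p.Prime] {A : BlockMatrix p (n + 1)}
    {ι : Fin (A.r + 1) → Fin (n + 1)} (hA : Presents A ι) {x : Fin (A.r + 1) → ℤ} {k : Fin A.r}
    (hk : ¬ ((p ^ (n + 1 - (ι k.succ).val) : ℕ) : ℤ) ∣ x k.succ) (a a' : ℕ) :
    weight p (A.comb x) a = weight p (A.comb x) a' := by
  classical
  obtain ⟨h, h0, h1⟩ := exists_torsion_mul_eq (Nat.sub_le _ _) hk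
  rw [hA.weight_comb, hA.weight_comb]
  let d : ZMod (p ^ (n + 1)) := a' - a
  rw [← Equiv.sum_comp (Equiv.addRight (Pi.single k (d * h))) fun g =>
    if IsTorsion (fun k => n + 1 - (ι k.succ).val) g then hitIndicator p x a' n g else 0]
  refine Finset.sum_congr rfl fun g _ => ?_
  have htors : IsTorsion (fun k => n + 1 - (ι k.succ).val) (g + Pi.single k (d * h)) ↔
      IsTorsion (fun k => n + 1 - (ι k.succ).val) g := by
    refine forall_congr' fun j => ?_
    rw [Pi.add_apply, mul_add]
    by_cases hj : j = k
    · subst hj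
      rw [Pi.single_eq_same, mul_left_comm, h0, mul_zero, add_zero]
    · rw [Pi.single_eq_of_ne hj, mul_zero, add_zero]
  have hhit : hitIndicator p x a' n (g + Pi.single k (d * h)) = hitIndicator p x a n g := by
    unfold hitIndicator
    refine if_congr ?_ rfl rfl
    simp only [Pi.add_apply, mul_add, Finset.sum_add_distrib, Pi.single_apply, mul_ite, mul_zero,
      Finset.sum_ite_eq', Finset.mem_univ, if_true, Nat.cast_mul]
    rw [mul_left_comm, h1]
    simp only [d]
    constructor <;> intro h <;> linear_combination h
  simp only [Equiv.coe_addRight, htors, hhit]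

/-- The rows other than row `0` are annihilated by their coefficients, and `x 0 * p ^ b` depends
only on `x 0` modulo `p`. -/
theorem Presents.comb_apply_of_dvd {p n : ℕ} [NeZero p] {A : BlockMatrix p (n + 1)}
    {ι : Fin (A.r + 1) → Fin (n + 1)} (hA : Presents A ι) {x : Fin (A.r + 1) → ℤ}
    (hx : ∀ k : Fin A.r, ((p ^ (n + 1 - (ι k.succ).val) : ℕ) : ℤ) ∣ x k.succ) (b : Fin (n + 1))
    (c : Fin (A.alpha b)) : A.comb x b c = (((x 0 : ZMod p).val * p ^ b.val : ℕ)) := by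
  have htors := (hA.represents b).isTorsion_tail (A.col_mem b c)
  rw [comb_apply, (hA.represents b).1 _ (A.col_mem b c), Finset.sum_eq_zero, add_zero]
  · obtain ⟨q, hq⟩ : (p : ℤ) ∣ x 0 - (x 0 : ZMod p).val := by
      rw [← ZMod.intCast_zmod_eq_zero_iff_dvd]
      simp
    have hp : (p : ZMod (p ^ (b.val + 1))) * (p ^ b.val : ℕ) = 0 := by
      rw [← Nat.cast_mul, ← pow_succ', ZMod.natCast_self]
    have hq' := congrArg (Int.cast : ℤ → ZMod (p ^ (b.val + 1))) hq
    rw [Int.cast_sub, Int.cast_mul, Int.cast_natCast, Int.cast_natCast] at hq'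
    rw [Nat.cast_mul]
    linear_combination ((p ^ b.val : ℕ) : ZMod (p ^ (b.val + 1))) * hq' + q * hp
  · intro k _
    obtain ⟨q, hq⟩ := hx k
    rw [hq, Int.cast_mul, Int.cast_natCast, mul_right_comm, htors k, zero_mul]

theorem Presents.weight_zero_ne {p n : ℕ} [Fact p.Prime] {A : BlockMatrix p (n + 1)}
    {ι : Fin (A.r + 1) → Fin (n + 1)} (hA : Presents A ι) :
    weight p (0 : Ambient p A.alpha) 0 ≠ weight p (0 : Ambient p A.alpha) 1 := by
  have hne : ∀ b : ℕ, (0 : ZMod (p ^ (b + 1))) ≠ (1 * p ^ b : ℕ) := by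
    intro b h
    have := (cast_mul_pow_eq_iff (p := p) (b := b) (a := 0) (a' := 1)).1 (by simpa using h)
    simp at this
  have hpos := hA.grayLength_pos
  simp only [weight, Pi.zero_apply, hne, if_false, zero_mul, Nat.cast_zero, if_true,
    Finset.sum_const, Finset.card_univ, Fintype.card_fin, smul_eq_mul, mul_one, mul_zero]
  simp only [grayLength, mul_comm] at hpos
  exact hpos.ne'

/-- The zero word has unequal weights at `0` and `1`, so it cannot fall under
`Presents.weight_comb_eq`; what remains is a multiple of row `0`, which has order `p`. -/
theorem Presents.comb_eq_zero_iff {p n : ℕ} [Fact p.Prime] {A : BlockMatrix p (n + 1)}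
    {ι : Fin (A.r + 1) → Fin (n + 1)} (hA : Presents A ι) (x : Fin (A.r + 1) → ℤ) :
    A.comb x = 0 ↔ ∀ k, ((p ^ (n + 1 - (ι k).val) : ℕ) : ℤ) ∣ x k := by
  have h0 : n + 1 - (ι 0).val = 1 := by
    have := hA.zero
    omega
  rw [Fin.forall_fin_succ, h0, pow_one, ← ZMod.intCast_zmod_eq_zero_iff_dvd]
  by_cases hx : ∀ k : Fin A.r, ((p ^ (n + 1 - (ι k.succ).val) : ℕ) : ℤ) ∣ x k.succ
  · rw [and_iff_left hx]
    constructor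
    · intro h
      have hlen : 0 < A.alpha 0 := List.length_pos_iff.2 (hA.represents 0).ne_nil
      have key := hA.comb_apply_of_dvd hx 0 ⟨0, hlen⟩
      rw [h] at key
      have := (cast_mul_pow_eq_iff (b := (0 : Fin (n + 1)).val) (a := 0)
        (a' := (x 0 : ZMod p).val)).1 (by rwa [zero_mul, Nat.cast_zero])
      rw [ZMod.natCast_zmod_val, Nat.cast_zero] at this
      exact this.symm
    · intro h
      funext b c
      rw [hA.comb_apply_of_dvd hx, h]
      simp
  · refine iff_of_false (fun h => ?_) fun h => hx h.2
    push Not at hx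
    obtain ⟨k, hk⟩ := hx
    have := hA.weight_comb_eq hk 0 1
    rw [h] at this
    exact hA.weight_zero_ne this

/-! ### The type of the code -/

/-- `A.comb` and the coefficientwise reduction `ψ` have the same kernel, so their images are
isomorphic. -/
theorem Presents.nonempty_equiv {p n : ℕ} [Fact p.Prime] {A : BlockMatrix p (n + 1)}
    {ι : Fin (A.r + 1) → Fin (n + 1)} (hA : Presents A ι) {t : Fin (n + 1) → ℕ}
    (e : (Σ i, Fin (t i)) ≃ Fin (A.r + 1)) (he : ∀ q, ι (e q) = q.1) :
    Nonempty (A.code ≃+ ((i : Fin (n + 1)) → Fin (t i) → ZMod (p ^ (n + 1 - i.val)))) := by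
  let ψ : (Fin (A.r + 1) → ℤ) →+ ((i : Fin (n + 1)) → Fin (t i) → ZMod (p ^ (n + 1 - i.val))) :=
    { toFun := fun x i j => x (e ⟨i, j⟩)
      map_zero' := by
        funext i j
        simp
      map_add' := fun x y => by
        funext i j
        simp }
  have hψ : Function.Surjective ψ := by
    intro y
    have hy : ∀ q : Σ i, Fin (t i), ∃ m : ℤ, (m : ZMod (p ^ (n + 1 - q.1.val))) = y q.1 q.2 :=
      fun q => ZMod.intCast_surjective _
    choose m hm using hy
    refine ⟨fun k => m (e.symm k), ?_⟩
    funext i j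
    simp only [ψ, AddMonoidHom.coe_mk, ZeroHom.coe_mk]
    rw [e.symm_apply_apply]
    exact hm ⟨i, j⟩
  have hker : A.comb.ker = ψ.ker := by
    ext x
    rw [AddMonoidHom.mem_ker, AddMonoidHom.mem_ker, hA.comb_eq_zero_iff, ← e.forall_congr_right,
      Sigma.forall, funext_iff]
    refine forall_congr' fun i => ?_
    rw [funext_iff]
    refine forall_congr' fun j => ?_
    rw [he]
    exact (ZMod.intCast_zmod_eq_zero_iff_dvd _ _).symm
  exact ⟨(AddEquiv.addSubgroupCongr (range_comb A).symm).trans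
    ((QuotientAddGroup.quotientKerEquivRange A.comb).symm.trans
      ((QuotientAddGroup.quotientAddEquivOfEq hker).trans
        (QuotientAddGroup.quotientKerEquivOfSurjective ψ hψ)))⟩

theorem exists_sigma_equiv {n r : ℕ} {ι : Fin r → Fin n} {t : Fin n → ℕ}
    (h : ∀ j, (Finset.univ.filter fun k => ι k = j).card = t j) :
    ∃ e : (Σ i, Fin (t i)) ≃ Fin r, ∀ q, ι (e q) = q.1 := by
  have hcard : ∀ i, Fintype.card {k // ι k = i} = t i := fun i => by
    rw [Fintype.card_subtype, h]
  refine ⟨(Equiv.sigmaCongrRight fun i => (Fintype.equivFinOfCardEq (hcard i)).symm).trans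
    (Equiv.sigmaFiberEquiv ι), fun q => ?_⟩
  exact ((Fintype.equivFinOfCardEq (hcard q.1)).symm q.2).2

theorem Presents.card_code {p n : ℕ} [Fact p.Prime] {A : BlockMatrix p (n + 1)}
    {ι : Fin (A.r + 1) → Fin (n + 1)} (hA : Presents A ι) {t : Fin (n + 1) → ℕ}
    (ht : ∀ j, (Finset.univ.filter fun k => ι k = j).card = t j) :
    Nat.card A.code = p * grayLength p A.alpha := by
  obtain ⟨e, he⟩ := exists_sigma_equiv ht
  obtain ⟨f⟩ := hA.nonempty_equiv e he
  have h0 : n + 1 - (ι 0).val = 1 := by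
    have := hA.zero
    omega
  have hprod : p * grayLength p A.alpha = ∏ k, p ^ (n + 1 - (ι k).val) := by
    rw [Fin.prod_univ_succ, h0, pow_one, hA.grayLength_eq]
  rw [hprod, ← e.prod_comp, Fintype.prod_sigma, Nat.card_congr f.toEquiv, Nat.card_pi]
  simp only [Nat.card_pi, Nat.card_zmod, he]

/-! ### The Gray image -/

theorem Presents.sub_cases {p n : ℕ} [Fact p.Prime] {A : BlockMatrix p (n + 1)}
    {ι : Fin (A.r + 1) → Fin (n + 1)} (hA : Presents A ι) {w : Ambient p A.alpha}
    (hw : w ∈ A.code) : (∀ a a', weight p w a = weight p w a') ∨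
      ∃ a : ℕ, a < p ∧ ∀ b c, w b c = (a * p ^ b.val : ℕ) := by
  rw [← range_comb] at hw
  obtain ⟨x, rfl⟩ := hw
  by_cases hx : ∀ k : Fin A.r, ((p ^ (n + 1 - (ι k.succ).val) : ℕ) : ℤ) ∣ x k.succ
  · exact Or.inr ⟨_, ZMod.val_lt _, hA.comb_apply_of_dvd hx⟩
  · push Not at hx
    obtain ⟨k, hk⟩ := hx
    exact Or.inl (hA.weight_comb_eq hk)

/-- The `p` value counts are equal and add up to the length `p * lam`. -/
theorem card_Phi_sub_of_weight {p s lam : ℕ} [Fact p.Prime] {α : Fin s → ℕ} {u v : Ambient p α}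
    (h : ∀ a a', weight p (u - v) a = weight p (u - v) a') (hN : grayLength p α = p * lam)
    (a : ZMod p) :
    (Finset.univ.filter fun k => Phi p α u k - Phi p α v k = a).card = lam := by
  have hall : ∀ a' : ZMod p, (Finset.univ.filter fun k => Phi p α u k - Phi p α v k = a').card =
      (Finset.univ.filter fun k => Phi p α u k - Phi p α v k = a).card := by
    intro a'
    have := card_Phi_sub_eq (h a'.val a.val)
    rwa [ZMod.natCast_zmod_val, ZMod.natCast_zmod_val] at this
  have hsum := Finset.card_eq_sum_card_fiberwise (s := (Finset.univ : Finset (Fin (grayLength p α))))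
    (t := (Finset.univ : Finset (ZMod p))) (f := fun k => Phi p α u k - Phi p α v k)
    fun _ _ => Finset.mem_coe.2 (Finset.mem_univ _)
  rw [Finset.sum_congr rfl fun a' _ => hall a', Finset.sum_const, Finset.card_univ,
    Finset.card_univ, Fintype.card_fin, ZMod.card, smul_eq_mul] at hsum
  exact Nat.eq_of_mul_eq_mul_left (Fact.out : p.Prime).pos (hsum.symm.trans hN)

theorem Phi_zero {p s : ℕ} (α : Fin s → ℕ) : Phi p α 0 = fun _ => 0 := by
  funext k
  simp [Phi, gray, digit]

theorem Presents.isAdditiveGHCode {p n : ℕ} [Fact p.Prime] {A : BlockMatrix p (n + 1)}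
    {ι : Fin (A.r + 1) → Fin (n + 1)} (hA : Presents A ι) {t : Fin (n + 1) → ℕ}
    (ht : ∀ j, (Finset.univ.filter fun k => ι k = j).card = t j) :
    IsAdditiveGHCode p A.alpha A.code := by
  obtain ⟨lam, hN⟩ : p ∣ grayLength p A.alpha := by
    rw [hA.grayLength_eq]
    refine (dvd_pow_self p ?_).trans (Finset.dvd_prod_of_mem _ (Finset.mem_univ ⟨0, hA.pos⟩))
    exact Nat.sub_ne_zero_of_lt (Fin.isLt _)
  have hpos := hA.grayLength_pos
  have hlam : 0 < lam := Nat.pos_of_ne_zero fun h => by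
    rw [hN, h, mul_zero] at hpos
    exact lt_irrefl 0 hpos
  have hconst : ∀ (u v : Ambient p A.alpha) (a : ℕ),
      (∀ b c, (u - v) b c = (a * p ^ b.val : ℕ)) →
      ∀ k, Phi p A.alpha u k - Phi p A.alpha v k = a := by
    intro u v a h k
    rw [sub_eq_iff_eq_add', ← Phi_add_const v (u - v) a h k, add_sub_cancel]
  -- For equal images the value `1` never occurs as a difference, which excludes the uniform case;
  -- in the constant case the constant is `0`.
  have hinj : Set.InjOn (Phi p A.alpha) (A.code : Set (Ambient p A.alpha)) := by
    intro u hu v hv huv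
    rcases hA.sub_cases (A.code.sub_mem hu hv) with h | ⟨a, ha, h⟩
    · have h1 := card_Phi_sub_of_weight h hN 1
      simp only [huv, sub_self, zero_ne_one, Finset.filter_false, Finset.card_empty] at h1
      exact absurd h1.symm hlam.ne'
    · have h1 := hconst u v a h ⟨0, hpos⟩
      rw [huv, sub_self] at h1
      have ha0 : a = 0 := by
        rw [← ZMod.val_natCast_of_lt ha, ← h1, ZMod.val_zero]
      refine sub_eq_zero.1 (funext fun b => funext fun c => ?_)
      rw [h, ha0, zero_mul, Nat.cast_zero]
      rfl
  refine isGHCode_of_differences _ hlam hN ⟨0, A.code.zero_mem, Phi_zero _⟩ ?_ ?_ ?_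
  · rintro _ ⟨u, hu, rfl⟩ a
    have hrow : A.row 0 ∈ A.code := AddSubgroup.subset_closure (Set.mem_range_self 0)
    refine ⟨u + a.val • A.row 0, A.code.add_mem hu (A.code.nsmul_mem hrow _), funext fun k => ?_⟩
    rw [Phi_add_const u _ a.val, ZMod.natCast_zmod_val]
    intro b c
    rw [Pi.smul_apply, Pi.smul_apply, row_zero hA, nsmul_eq_mul, Nat.cast_mul]
  · rw [Nat.card_image_of_injOn hinj]
    exact hA.card_code ht
  · rintro _ ⟨u, hu, rfl⟩ _ ⟨v, hv, rfl⟩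
    rcases hA.sub_cases (A.code.sub_mem hu hv) with h | ⟨a, -, h⟩
    · exact Or.inr (card_Phi_sub_of_weight h hN)
    · exact Or.inl ⟨a, hconst u v a h⟩

end GHCode

theorem theorem1 (p : ℕ) (hp : p.Prime) (s : ℕ) (hs : 2 ≤ s) (t : Fin s → ℕ)
    (ht_first : 1 ≤ t ⟨0, by omega⟩) (ht_last : 1 ≤ t ⟨s - 1, by omega⟩) :
    GHCode.IsAdditiveGHCode p (GHCode.genMatrix p t).alpha (GHCode.genMatrix p t).code ∧
      GHCode.HasType p (GHCode.genMatrix p t).alpha t (GHCode.genMatrix p t).code := by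
  have : Fact p.Prime := ⟨hp⟩
  obtain ⟨n, rfl⟩ : ∃ n, s = n + 1 := ⟨s - 1, by omega⟩
  obtain ⟨ι, hA, ht⟩ := GHCode.exists_presents_genMatrix (p := p) (by omega) t ht_first ht_last
  obtain ⟨e, he⟩ := GHCode.exists_sigma_equiv ht
  exact ⟨hA.isAdditiveGHCode ht, hA.nonempty_equiv e he⟩
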